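/- \textbf{Setting.} De Bruijn terms are $t ::= c \mid x \mid \#i \mid (t\ t) \mid (\lambda\, t)$ with constants $c$, instantiatable variables $x$ and indices $i\ge 1$. For a sequence of terms $s_1,s_2,\dots$ the simultaneous substitution $S(t;s_1,s_2,\dots)$ fixes constants and instantiatable variables, sends $\#i$ to $s_i$, commutes with application, and satisfies $S(\lambda\,t;s_1,s_2,\dots)=\lambda\,S(t;\#1,s_1',s_2',\dots)$ with $s_i'=S(s_i;\#2,\#3,\dots)$. A $\beta$-contraction replaces a subterm $((\lambda\,t_1)\ t_2)$ by $S(t_1;t_2,\#1,\#2,\dots)$; $\beta$-reduction is a finite, possibly empty, series of contractions. A head normal form is a term $\lambda\cdots\lambda\,(\cdots(h\ t_1)\cdots t_m)$ with $n\ge0$ binders and $m\ge0$ arguments, whose head $h$ is a constant, an instantiatable variable or a variable reference; it is a head normal form \emph{of} $t$ if moreover $t$ $\beta$-reduces to it. \textbf{Representation.} Terms are represented by references to mutable cells containing $\mathit{const}(c)$, $\mathit{fv}(x)$, $\mathit{bv}(i)$, $\mathit{app}(p_1,p_2)$, $\mathit{lam}(p)$ or an indirection $\mathit{ptr}(p)$,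 where $p,p_1,p_2$ are references; a store is thus a directed graph, and the expression at a reference is acyclic if no cell reachable from it lies on a cycle. Environments are lists of items $\mathit{dum}(l)$ and $\mathit{bndg}(\mathit{cl}(p,ol,nl,env),l)$; the numbers are (unbounded) integers and $\mathit{nth}(env,i)$ is the $i$-th item, counted from $1$. \textbf{Procedures.} $\mathit{deref}(p)$ follows $\mathit{ptr}$ cells to their end. $\mathit{assign}(p,q)$ overwrites $p$ by $\mathit{ptr}(\mathit{deref}(q))$. $\mathit{ref}(\cdot)$ allocates a new cell. $\mathit{subst}(p,ol,nl,env)$, by the contents of $p$: \begin{itemize} \item $\mathit{app}(p_1,p_2)$: $\mathit{ref}(\mathit{app}(\mathit{subst}(p_1,ol,nl,env),\mathit{subst}(p_2,ol,nl,env)))$; \item $\mathit{lam}(q)$: $\mathit{ref}(\mathit{lam}(\mathit{subst}(q,ol+1,nl+1,\mathit{dum}(nl)::env)))$; \item $\mathit{bv}(i)$: if $i>ol$, $\mathit{ref}(\mathit{bv}(i-ol+nl))$; otherwise, if $\mathit{nth}(env,i)=\mathit{dum}(l)$, $\mathit{ref}(\mathit{bv}(nl-l))$, and if $\mathit{nth}(env,i)=\mathit{bndg}(\mathit{cl}(q,ol',nl',e'),l)$,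 then $q$ if $ol'=0$ and $nl+nl'-l=0$, else $\mathit{subst}(q,ol',nl+nl'-l,e')$; \item $\mathit{ptr}(q)$: $\mathit{subst}(\mathit{deref}(q),ol,nl,env)$; otherwise: $p$. \end{itemize} $\mathit{hn\_eb}(p,ol,nl,env,w)$, with $w$ a Boolean (true: weak mode), by the contents of $p$: \begin{itemize} \item $\mathit{bv}(i)$: if $ol=nl=0$ and $env=nil$, $(p,0,0,nil)$; else if $i>ol$, $(\mathit{ref}(\mathit{bv}(i-ol+nl)),0,0,nil)$; else if $\mathit{nth}(env,i)=\mathit{dum}(l)$, $(\mathit{ref}(\mathit{bv}(nl-l)),0,0,nil)$; else, with $\mathit{nth}(env,i)=\mathit{bndg}(\mathit{cl}(q,ol',nl',env'),l)$, $\mathit{hn\_eb}(q,ol',nl',env',w)$ if $l=nl$ and $\mathit{hn\_eb}(q,ol',nl+nl'-l,env',w)$ if $l\neq nl$; \item $\mathit{lam}(q)$: if $w$ is true, $(p,ol,nl,env)$. If $w$ is false and $ol=nl=0$, call $\mathit{hn\_eb}(q,0,0,nil,\mathit{false})$ and return $(p,0,0,nil)$; otherwise let $q'$ be the first component of $\mathit{hn\_eb}(q,ol+1,nl+1,\mathit{dum}(nl)::env,\mathit{false})$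 and return $(\mathit{ref}(\mathit{lam}(q')),0,0,nil)$; \item $\mathit{app}(p_1,p_2)$: let $(f,fo,fl,ef)=\mathit{hn\_eb}(p_1,ol,nl,env,\mathit{true})$ and $f'=\mathit{deref}(f)$. If $f'$ contains $\mathit{lam}(q)$, let $s=\mathit{hn\_eb}(q,fo+1,fl,\mathit{bndg}(\mathit{cl}(p_2,ol,nl,env),nl)::ef,w)$; if $ol=nl=0$ and $s=(r,0,0,nil)$, do $\mathit{assign}(p,r)$; return $s$. If $f'$ does not contain a $\mathit{lam}$: if $ol=nl=0$ and $env=nil$, do $\mathit{assign}(p,\mathit{ref}(\mathit{app}(f',p_2)))$ and return $(p,0,0,nil)$; otherwise return $(\mathit{ref}(\mathit{app}(f',\mathit{subst}(p_2,ol,nl,env))),0,0,nil)$; \item $\mathit{ptr}(q)$: $\mathit{hn\_eb}(\mathit{deref}(q),ol,nl,env,w)$; otherwise: $(p,0,0,nil)$. \end{itemize} Finally $\mathit{head\_norm1}(p)=\mathit{hn\_eb}(p,0,0,nil,\mathit{false})$. \textbf{Theorem.} Let $t'$ be a reference to an acyclic expression representing a de Bruijn term $t$ that has a head normal form. Then $\mathit{head\_norm1}(t')$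 terminates normally. It preserves acyclicity: every reference whose expression is acyclic before the call has an acyclic expression after it. The call returns a quadruple of the form $(r',0,0,nil)$, and at its end $t'$ and $r'$ both refer to representations of one and the same head normal form of $t$. -/

import Mathlib

namespace EnvReduction

/-! ### De Bruijn terms -/

/-- De Bruijn terms over constants and instantiatable variables (both named by strings).
Indices are stored from zero: `var i` is the variable reference written `#(i+1)`. -/
inductive DTerm : Type
  | const (c : String)
  | fvar (x : String)
  | var (i : ℕ)
  | app (t₁ t₂ : DTerm)
  | lam (t : DTerm)

namespace DTerm

/-- The renumbering used under an abstraction: index `#1` is kept, the others follow `f`. -/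
def liftRen (f : ℕ → ℕ) : ℕ → ℕ
  | 0 => 0
  | i + 1 => f i + 1

/-- Renumbering of the free indices. -/
def rename : DTerm → (ℕ → ℕ) → DTerm
  | const c, _ => const c
  | fvar x, _ => fvar x
  | var i, f => var (f i)
  | app t₁ t₂, f => app (rename t₁ f) (rename t₂ f)
  | lam t, f => lam (rename t (liftRen f))

/-- The sequence `#1, s₁', s₂', …` with `sᵢ' = S(sᵢ; #2, #3, …)`;
see `rename_succ` for the agreement with `S`. -/
def liftSubst (s : ℕ → DTerm) : ℕ → DTerm
  | 0 => var 0
  | i + 1 => rename (s i) Nat.succ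

/-- Simultaneous substitution `S(t; s₁, s₂, …)`; `s i` replaces the index `#(i+1)`. -/
def S : DTerm → (ℕ → DTerm) → DTerm
  | const c, _ => const c
  | fvar x, _ => fvar x
  | var i, s => s i
  | app t₁ t₂, s => app (S t₁ s) (S t₂ s)
  | lam t, s => lam (S t (liftSubst s))

theorem rename_eq_S (t : DTerm) : ∀ f : ℕ → ℕ, rename t f = S t (fun i => var (f i)) := by
  induction t with
  | const c => intro f; rfl
  | fvar x => intro f; rfl
  | var i => intro f; rfl
  | app t₁ t₂ h₁ h₂ => intro f; simp only [rename, S, h₁, h₂]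
  | lam t ih =>
    intro f
    have e : (fun i => var (liftRen f i)) = liftSubst (fun i => var (f i)) := by
      funext i
      cases i <;> rfl
    simp only [rename, S, ih, e]

/-- The shift in `liftSubst` is `S(t; #2, #3, …)`. -/
theorem rename_succ (t : DTerm) : rename t Nat.succ = S t (fun i => var (i + 1)) :=
  rename_eq_S t Nat.succ

/-- The sequence `t, #1, #2, …`. -/
def single (t : DTerm) : ℕ → DTerm
  | 0 => t
  | i + 1 => var i

/-- One `β`-contraction, at an arbitrary subterm. -/
inductive Beta : DTerm → DTerm → Prop
  | contract (t₁ t₂ : DTerm) : Beta (app (lam t₁) t₂) (S t₁ (single t₂))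
  | appLeft {t₁ t₁' : DTerm} (t₂ : DTerm) : Beta t₁ t₁' → Beta (app t₁ t₂) (app t₁' t₂)
  | appRight (t₁ : DTerm) {t₂ t₂' : DTerm} : Beta t₂ t₂' → Beta (app t₁ t₂) (app t₁ t₂')
  | lam {t t' : DTerm} : Beta t t' → Beta (lam t) (lam t')

/-- `β`-reduction: a finite, possibly empty, series of contractions. -/
def BetaReduces : DTerm → DTerm → Prop := Relation.ReflTransGen Beta

/-- Constants, instantiatable variables and variable references: the possible heads. -/
def IsAtom : DTerm → Prop
  | const _ => True
  | fvar _ => True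
  | var _ => True
  | app _ _ => False
  | lam _ => False

/-- Head normal forms `λ … λ (… (h t₁) … tₘ)` with `n` binders, head `h` and arguments `tᵢ`. -/
def IsHNF (t : DTerm) : Prop :=
  ∃ (n : ℕ) (h : DTerm) (args : List DTerm),
    h.IsAtom ∧ t = lam^[n] (args.foldl app h)

/-- `s` is a head normal form of `t`. -/
def IsHNFOf (s t : DTerm) : Prop := BetaReduces t s ∧ IsHNF s

end DTerm

/-! ### The store of reference cells -/

/-- References to cells of the store. -/
abbrev Loc : Type := ℕ

/-- The contents of reference cells:
`const of string | bv of int | fv of string | ptr of (rawterm ref)`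
`| app of (rawterm ref * rawterm ref) | lam of (rawterm ref)`. -/
inductive RawTerm : Type
  | const (c : String)
  | bv (i : ℤ)
  | fv (x : String)
  | ptr (t : Loc)
  | app (t₁ t₂ : Loc)
  | lam (t : Loc)

/-- Environment items: `dum l`, and `bndg t ol nl e l` for `bndg(cl(t,ol,nl,e),l)`. -/
inductive EItem : Type
  | dum (l : ℤ)
  | bndg (t : Loc) (ol nl : ℤ) (e : List EItem) (l : ℤ)

abbrev Env : Type := List EItem

/-- The store: cell number `p` contains the entry of the list at position `p`. -/
abbrev Heap : Type := List RawTerm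

/-- The contents `!p` of a cell. -/
def Heap.read (h : Heap) (p : Loc) : Option RawTerm := h[p]?

/-- The allocation `ref(r)` of a new cell. -/
def Heap.alloc (h : Heap) (r : RawTerm) : Heap × Loc := (h ++ [r], h.length)

/-- The assignment `p := r`. -/
def Heap.write (h : Heap) (p : Loc) (r : RawTerm) : Heap := h.set p r

/-- The references that occur in the contents of a cell. -/
def RawTerm.refs : RawTerm → List Loc
  | const _ => []
  | bv _ => []
  | fv _ => []
  | ptr t => [t]
  | app t₁ t₂ => [t₁, t₂]
  | lam t => [t]

/-- The edges of the directed graph given by a store. -/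
def Heap.Edge (h : Heap) (p q : Loc) : Prop := ∃ r, h.read p = some r ∧ q ∈ r.refs

/-- The expression at `p` is acyclic: no cell reachable from `p` lies on a cycle. -/
def Heap.Acyclic (h : Heap) (p : Loc) : Prop :=
  ∀ q, Relation.ReflTransGen h.Edge p q → ¬ Relation.TransGen h.Edge q q

/-- `Represents h p t`: in the store `h` the reference `p` refers to a representation of the
de Bruijn term `t`; `ptr` cells are indirections. -/
inductive Represents (h : Heap) : Loc → DTerm → Prop
  | const {p : Loc} {c : String} : h.read p = some (.const c) → Represents h p (.const c)
  | fv {p : Loc} {x : String} : h.read p = some (.fv x) → Represents h p (.fvar x)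
  | bv {p : Loc} {i : ℕ} : h.read p = some (.bv ((i : ℤ) + 1)) → Represents h p (.var i)
  | ptr {p q : Loc} {t : DTerm} :
      h.read p = some (.ptr q) → Represents h q t → Represents h p t
  | app {p p₁ p₂ : Loc} {t₁ t₂ : DTerm} :
      h.read p = some (.app p₁ p₂) → Represents h p₁ t₁ → Represents h p₂ t₂ →
        Represents h p (.app t₁ t₂)
  | lam {p q : Loc} {t : DTerm} :
      h.read p = some (.lam q) → Represents h q t → Represents h p (.lam t)

/-! ### The procedures

A procedure takes the current store and returns the final store and its value. The recursive
procedures carry a bound on the depth of nested calls as their first argument and give `none`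
when this bound is exhausted; `none` also stands for an exception (a failed match). Thus a call
terminates normally with the outcome `x` exactly if it gives `some x` for all sufficiently
large bounds. -/

/-- `deref` follows the indirections. -/
def deref : ℕ → Heap → Loc → Option Loc
  | 0, _, _ => none
  | k + 1, h, term => do
    match ← h.read term with
    | .ptr t => deref k h t
    | _ => some term

/-- `assign(t1,t2)` sets `t1` to an indirection to the end of the `ptr` chain at `t2`. -/
def assign : ℕ → Heap → Loc → Loc → Option Heap
  | 0, _, _, _ => none
  | k + 1, h, t₁, t₂ => do
    match ← h.read t₂ with
    | .ptr t => assign k h t₁ t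
    | _ => some (h.write t₁ (.ptr t₂))

/-- `nth` looks up an environment; positions start at `1`. -/
def nth : Env → ℤ → Option EItem
  | [], _ => none
  | x :: l, n => if n = 1 then some x else nth l (n - 1)

/-- `subst(term,ol,nl,env)` calculates out a suspension. -/
def subst : ℕ → Heap → Loc → ℤ → ℤ → Env → Option (Heap × Loc)
  | 0, _, _, _, _, _ => none
  | k + 1, h, term, ol, nl, env => do
    match ← h.read term with
    | .app t₁ t₂ =>
      let (h₁, r₁) ← subst k h t₁ ol nl env
      let (h₂, r₂) ← subst k h₁ t₂ ol nl env
      some (h₂.alloc (.app r₁ r₂))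
    | .lam t =>
      let (h₁, r) ← subst k h t (ol + 1) (nl + 1) (.dum nl :: env)
      some (h₁.alloc (.lam r))
    | .bv i =>
      if i > ol then
        some (h.alloc (.bv (i - ol + nl)))
      else
        match ← nth env i with
        | .dum l => some (h.alloc (.bv (nl - l)))
        | .bndg t ol' nl' e' l =>
          if ol' = 0 ∧ nl + nl' - l = 0 then
            some (h, t)
          else
            subst k h t ol' (nl + nl' - l) e'
    | .ptr t =>
      let t' ← deref k h t
      subst k h t' ol nl env
    | _ => some (h, term)

/-- The quadruples `(t,ol,nl,env)` returned by the reduction procedure. -/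
abbrev Quad : Type := Loc × ℤ × ℤ × Env

/-- `build_lam(term,body,ol,nl)`. -/
def buildLam (h : Heap) (term body : Loc) (ol nl : ℤ) : Heap × Quad :=
  if ol = 0 ∧ nl = 0 then
    (h, (term, 0, 0, []))
  else
    let (h₁, r) := h.alloc (.lam body)
    (h₁, (r, 0, 0, []))

/-- `update_app(term,s,ol,nl)`. -/
def updateApp (k : ℕ) (h : Heap) (term : Loc) (s : Quad) (ol nl : ℤ) :
    Option (Heap × Quad) := do
  let (t, sol, snl, senv) := s
  if sol = 0 ∧ snl = 0 ∧ senv.isEmpty ∧ ol = 0 ∧ nl = 0 then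
    let h₁ ← assign k h term t
    some (h₁, (t, 0, 0, []))
  else
    some (h, s)

/-- `build_app(term,f,arg,ol,nl,env)`. -/
def buildApp (k : ℕ) (h : Heap) (term f arg : Loc) (ol nl : ℤ) (env : Env) :
    Option (Heap × Quad) := do
  if ol = 0 ∧ nl = 0 ∧ env.isEmpty then
    let (h₁, r) := h.alloc (.app f arg)
    let h₂ ← assign k h₁ term r
    some (h₂, (term, 0, 0, []))
  else
    let (h₁, a) ← subst k h arg ol nl env
    let (h₂, r) := h₁.alloc (.app f a)
    some (h₂, (r, 0, 0, []))

/-- `hn_eb(term,ol,nl,env,whnf)`: environment based (weak) head normalization. -/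
def hnEb : ℕ → Heap → Loc → ℤ → ℤ → Env → Bool → Option (Heap × Quad)
  | 0, _, _, _, _, _, _ => none
  | k + 1, h, term, ol, nl, env, whnf => do
    match ← h.read term with
    | .bv i =>
      if ol = 0 ∧ nl = 0 ∧ env.isEmpty then
        some (h, (term, 0, 0, []))
      else if i > ol then
        let (h₁, r) := h.alloc (.bv (i - ol + nl))
        some (h₁, (r, 0, 0, []))
      else
        match ← nth env i with
        | .dum l =>
          let (h₁, r) := h.alloc (.bv (nl - l))
          some (h₁, (r, 0, 0, []))
        | .bndg t' ol' nl' env' l =>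
          if l = nl then
            hnEb k h t' ol' nl' env' whnf
          else
            hnEb k h t' ol' (nl + nl' - l) env' whnf
    | .lam t =>
      if whnf then
        some (h, (term, ol, nl, env))
      else
        let (h₁, (t', _, _, _)) ←
          if ol = 0 ∧ nl = 0 then
            hnEb k h t 0 0 [] false
          else
            hnEb k h t (ol + 1) (nl + 1) (.dum nl :: env) false
        some (buildLam h₁ term t' ol nl)
    | .app t₁ t₂ =>
      let (h₁, (f, fo, fl, ef)) ← hnEb k h t₁ ol nl env true
      let f' ← deref k h₁ f
      match ← h₁.read f' with
      | .lam t =>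
        let (h₂, s) ← hnEb k h₁ t (fo + 1) fl (.bndg t₂ ol nl env nl :: ef) whnf
        updateApp k h₂ term s ol nl
      | _ => buildApp k h₁ term f' t₂ ol nl env
    | .ptr t₁ =>
      let t' ← deref k h t₁
      hnEb k h t' ol nl env whnf
    | _ => some (h, (term, 0, 0, []))

/-- `head_norm1(t) = hn_eb(t,0,0,nil,false)`, run with the bound `k`. -/
def headNorm1 (k : ℕ) (h : Heap) (t : Loc) : Option (Heap × Quad) :=
  hnEb k h t 0 0 [] false

end EnvReduction

/-!
The theorem compares the graph reducer with a cost-indexed big-step head evaluation of terms,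
`Eval w n t v`: the term `t` evaluates to `v`, in weak or strong mode, by `n` contractions.

*Terms.* A term with a head normal form has a standard reduction to it, and a standard reduction
starts with the weak head steps that `Eval` needs (`IsHNFOf.exists_eval`, by Kashima's inductive
definition of standard reduction). Moreover, if `t` reduces to `t'`, then `t'` evaluates at no
higher cost than `t` (`Eval.of_reduces`, through parallel reduction). This is what makes sharing
harmless: an in-place update replaces terms by reducts, also in suspensions that are still to be
evaluated, and can therefore only shorten the remaining evaluations.

*Store.* A computation is confined to a working area `X` (`Heap.Good`): a set of cells which
contains all future cells, which no edge leaves, and whose allocated cells hold representations.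
Cells outside `X` do not change, and every represented term changes only by `β`-reduction
(`Heap.Step`). In the empty environment at level `0` the cell `p` under evaluation may be
overwritten; there the recursive calls work in the area strictly below `p`, which does not contain
`p`, so that the indirection from `p` to the result closes no cycle (`Heap.Step.write`).
As representations are well-founded graphs, acyclicity is preserved (`Heap.Step.acyclic`).

*Suspensions.* A quadruple `(p, ol, nl, env)` with `p` representing `t` denotes `S(t; σ)`, where
`σ` is the substitution denoted by `env` at level `nl` (`EnvRep`). By induction on the cost of the
denoted term, then on the nesting depth of closures in `env`, then on `t`, a call of `hnEb`
terminates and returns a suspension of a reduct of the value of that term (`hnEb_spec`): the first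
call for an application does not cost more and is on a smaller term, the call after a contraction
costs less, and the lookup of a closure lowers the depth.
-/

namespace EnvReduction

namespace DTerm

/-! ### Substitution -/

/-- The sequence `a, s₁, s₂, …`. -/
def scons (a : DTerm) (s : ℕ → DTerm) : ℕ → DTerm
  | 0 => a
  | i + 1 => s i

theorem liftRen_comp (f g : ℕ → ℕ) : (fun i => liftRen g (liftRen f i)) =
    liftRen (fun i => g (f i)) := by
  funext i
  cases i <;> rfl

theorem rename_rename (t : DTerm) : ∀ f g : ℕ → ℕ,
    rename (rename t f) g = rename t (fun i => g (f i)) := by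
  induction t with
  | const c => intros; rfl
  | fvar x => intros; rfl
  | var i => intros; rfl
  | app t₁ t₂ h₁ h₂ => intro f g; simp only [rename, h₁, h₂]
  | lam t ih => intro f g; simp only [rename, ih, liftRen_comp]

theorem liftSubst_var : liftSubst var = var := by
  funext i
  cases i <;> rfl

theorem S_var (t : DTerm) : S t var = t := by
  induction t with
  | const c => rfl
  | fvar x => rfl
  | var i => rfl
  | app t₁ t₂ h₁ h₂ => simp only [S, h₁, h₂]
  | lam t ih => simp only [S, liftSubst_var, ih]

theorem S_rename (t : DTerm) : ∀ (f : ℕ → ℕ) (s : ℕ → DTerm),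
    S (rename t f) s = S t (fun i => s (f i)) := by
  induction t with
  | const c => intros; rfl
  | fvar x => intros; rfl
  | var i => intros; rfl
  | app t₁ t₂ h₁ h₂ => intro f s; simp only [rename, S, h₁, h₂]
  | lam t ih =>
    intro f s
    have e : (fun i => liftSubst s (liftRen f i)) = liftSubst (fun i => s (f i)) := by
      funext i
      cases i <;> rfl
    simp only [rename, S, ih, e]

theorem rename_liftSubst (s : ℕ → DTerm) (f : ℕ → ℕ) :
    (fun i => rename (liftSubst s i) (liftRen f)) = liftSubst (fun i => rename (s i) f) := by
  funext i
  cases i with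
  | zero => rfl
  | succ i => simp only [liftSubst, rename_rename, liftRen, Nat.succ_eq_add_one]

theorem rename_S (t : DTerm) : ∀ (s : ℕ → DTerm) (f : ℕ → ℕ),
    rename (S t s) f = S t (fun i => rename (s i) f) := by
  induction t with
  | const c => intros; rfl
  | fvar x => intros; rfl
  | var i => intros; rfl
  | app t₁ t₂ h₁ h₂ => intro s f; simp only [rename, S, h₁, h₂]
  | lam t ih => intro s f; simp only [rename, S, ih, rename_liftSubst]

theorem S_liftSubst (s s' : ℕ → DTerm) :
    (fun i => S (liftSubst s i) (liftSubst s')) = liftSubst (fun i => S (s i) s') := by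
  funext i
  cases i with
  | zero => rfl
  | succ i => simp only [liftSubst, S_rename, rename_S]

theorem S_S (t : DTerm) : ∀ s s' : ℕ → DTerm, S (S t s) s' = S t (fun i => S (s i) s') := by
  induction t with
  | const c => intros; rfl
  | fvar x => intros; rfl
  | var i => intros; rfl
  | app t₁ t₂ h₁ h₂ => intro s s'; simp only [S, h₁, h₂]
  | lam t ih => intro s s'; simp only [S, ih, S_liftSubst]

theorem S_liftSubst_single (t a : DTerm) (s : ℕ → DTerm) :
    S (S t (liftSubst s)) (single a) = S t (scons a s) := by
  rw [S_S]
  congr 1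
  funext i
  cases i with
  | zero => rfl
  | succ i =>
    simp only [liftSubst, S_rename, scons, single]
    exact S_var _

theorem S_single_S (t a : DTerm) (s : ℕ → DTerm) :
    S (S t (single a)) s = S (S t (liftSubst s)) (single (S a s)) := by
  rw [S_liftSubst_single, S_S]
  congr 1
  funext i
  cases i <;> rfl

theorem rename_S_single (t a : DTerm) (f : ℕ → ℕ) :
    rename (S t (single a)) f = S (rename t (liftRen f)) (single (rename a f)) := by
  rw [rename_S, S_rename]
  congr 1
  funext i
  cases i <;> rfl

/-! ### `β`-reduction -/

namespace BetaReduces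

theorem refl (t : DTerm) : BetaReduces t t := Relation.ReflTransGen.refl

theorem trans {t u v : DTerm} (h₁ : BetaReduces t u) (h₂ : BetaReduces u v) :
    BetaReduces t v := Relation.ReflTransGen.trans h₁ h₂

theorem app {t t' u u' : DTerm} (h₁ : BetaReduces t t') (h₂ : BetaReduces u u') :
    BetaReduces (app t u) (app t' u') :=
  (h₁.lift (fun x => DTerm.app x u) fun _ _ h => Beta.appLeft u h).trans
    (h₂.lift (fun x => DTerm.app t' x) fun _ _ h => Beta.appRight t' h)

theorem lam {t t' : DTerm} (h : BetaReduces t t') : BetaReduces (lam t) (lam t') :=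
  h.lift _ fun _ _ h => Beta.lam h

end BetaReduces

theorem Beta.S {t t' : DTerm} (h : Beta t t') : ∀ s, Beta (S t s) (S t' s) := by
  induction h with
  | contract t₁ t₂ => intro s; rw [S_single_S]; exact Beta.contract _ _
  | appLeft t₂ _ ih => intro s; exact Beta.appLeft _ (ih s)
  | appRight t₁ _ ih => intro s; exact Beta.appRight _ (ih s)
  | lam _ ih => intro s; exact Beta.lam (ih _)

theorem BetaReduces.rename {t t' : DTerm} (h : BetaReduces t t') (f : ℕ → ℕ) :
    BetaReduces (rename t f) (rename t' f) := by
  rw [rename_eq_S, rename_eq_S]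
  exact h.lift (fun x => DTerm.S x _) fun _ _ h => h.S _

theorem S_congr_reduces (t : DTerm) : ∀ {s s' : ℕ → DTerm}, (∀ i, BetaReduces (s i) (s' i)) →
    BetaReduces (S t s) (S t s') := by
  induction t with
  | const c => intros; exact .refl _
  | fvar x => intros; exact .refl _
  | var i => intro s s' h; exact h i
  | app t₁ t₂ h₁ h₂ => intro s s' h; exact (h₁ h).app (h₂ h)
  | lam t ih =>
    intro s s' h
    refine (ih fun i => ?_).lam
    cases i with
    | zero => exact .refl _
    | succ i => exact (h i).rename _

theorem BetaReduces.S {t t' : DTerm} {s s' : ℕ → DTerm} (h : BetaReduces t t')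
    (hs : ∀ i, BetaReduces (s i) (s' i)) : BetaReduces (S t s) (S t' s') :=
  (h.lift (fun x => DTerm.S x s) fun _ _ h => h.S _).trans (S_congr_reduces t' hs)

theorem BetaReduces.contractum {t t' a a' : DTerm} (h : BetaReduces t t')
    (ha : BetaReduces a a') : BetaReduces (DTerm.S t (single a)) (DTerm.S t' (single a')) := by
  refine h.S fun i => ?_
  cases i with
  | zero => exact ha
  | succ i => exact .refl _

theorem BetaReduces.lam_inv {t u : DTerm} (h : BetaReduces (DTerm.lam t) u) :
    ∃ t', u = DTerm.lam t' ∧ BetaReduces t t' := by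
  induction h with
  | refl => exact ⟨t, rfl, .refl _⟩
  | tail _ h ih =>
    obtain ⟨t', rfl, ht⟩ := ih
    cases h with
    | lam h => exact ⟨_, rfl, ht.tail h⟩

/-! ### Head normal forms -/

/-- The terms `(… (h t₁) … tₘ)` with an atomic head `h`. -/
inductive Neutral : DTerm → Prop
  | atom {t : DTerm} : t.IsAtom → Neutral t
  | app {t : DTerm} (u : DTerm) : Neutral t → Neutral (app t u)

theorem not_neutral_lam {t : DTerm} : ¬ Neutral (lam t) := by
  intro h
  cases h with
  | atom h => exact h

theorem Neutral.beta {t t' : DTerm} (ht : Neutral t) (h : Beta t t') : Neutral t' := by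
  induction h with
  | contract t₁ t₂ =>
    cases ht with
    | atom h => exact h.elim
    | app _ h => exact (not_neutral_lam h).elim
  | appLeft t₂ _ ih =>
    cases ht with
    | atom h => exact h.elim
    | app _ h => exact .app _ (ih h)
  | appRight t₁ _ _ =>
    cases ht with
    | atom h => exact h.elim
    | app _ h => exact .app _ h
  | lam _ _ => exact (not_neutral_lam ht).elim

theorem Neutral.reduces {t t' : DTerm} (ht : Neutral t) (h : BetaReduces t t') :
    Neutral t' := by
  induction h with
  | refl => exact ht
  | tail _ h ih => exact ih.beta h

/-- An inductive description of `IsHNF`. -/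
inductive HNF : DTerm → Prop
  | neutral {t : DTerm} : Neutral t → HNF t
  | lam {t : DTerm} : HNF t → HNF (lam t)

theorem neutral_foldl (args : List DTerm) : ∀ {t : DTerm}, Neutral t →
    Neutral (args.foldl app t) := by
  induction args with
  | nil => intro t h; exact h
  | cons a args ih => intro t h; exact ih (.app a h)

theorem IsHNF.hnf {t : DTerm} (h : IsHNF t) : HNF t := by
  obtain ⟨n, a, args, ha, rfl⟩ := h
  induction n with
  | zero => exact .neutral (neutral_foldl args (.atom ha))
  | succ n ih => rw [Function.iterate_succ_apply']; exact .lam ih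

theorem Neutral.exists_foldl {t : DTerm} (h : Neutral t) :
    ∃ (a : DTerm) (args : List DTerm), a.IsAtom ∧ t = args.foldl DTerm.app a := by
  induction h with
  | atom h => exact ⟨_, [], h, rfl⟩
  | app u _ ih =>
    obtain ⟨a, args, ha, rfl⟩ := ih
    exact ⟨a, args ++ [u], ha, by simp⟩

theorem HNF.isHNF {t : DTerm} (h : HNF t) : IsHNF t := by
  induction h with
  | neutral h =>
    obtain ⟨a, args, ha, rfl⟩ := h.exists_foldl
    exact ⟨0, a, args, ha, rfl⟩
  | lam _ ih =>
    obtain ⟨n, a, args, ha, rfl⟩ := ih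
    exact ⟨n + 1, a, args, ha, (Function.iterate_succ_apply' _ _ _).symm⟩

theorem HNF.reduces {t t' : DTerm} (ht : HNF t) : BetaReduces t t' → HNF t' := by
  induction ht generalizing t' with
  | neutral ht => intro h; exact .neutral (ht.reduces h)
  | lam _ ih =>
    intro h
    obtain ⟨u, rfl, hu⟩ := h.lam_inv
    exact .lam (ih hu)

/-! ### Parallel reduction -/

/-- Parallel reduction: simultaneous contraction of a set of redexes. -/
inductive Par : DTerm → DTerm → Prop
  | const (c : String) : Par (const c) (const c)
  | fvar (x : String) : Par (fvar x) (fvar x)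
  | var (i : ℕ) : Par (var i) (var i)
  | app {t t' u u' : DTerm} : Par t t' → Par u u' → Par (app t u) (app t' u')
  | lam {t t' : DTerm} : Par t t' → Par (lam t) (lam t')
  | beta {t t' u u' : DTerm} : Par t t' → Par u u' →
      Par (app (lam t) u) (S t' (single u'))

theorem Par.refl (t : DTerm) : Par t t := by
  induction t with
  | const c => exact .const c
  | fvar x => exact .fvar x
  | var i => exact .var i
  | app _ _ h₁ h₂ => exact .app h₁ h₂
  | lam _ ih => exact .lam ih

theorem Par.rename {t t' : DTerm} (h : Par t t') : ∀ f, Par (rename t f) (rename t' f) := by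
  induction h with
  | const c => intro f; exact .const c
  | fvar x => intro f; exact .fvar x
  | var i => intro f; exact .var _
  | app _ _ h₁ h₂ => intro f; exact .app (h₁ f) (h₂ f)
  | lam _ ih => intro f; exact .lam (ih _)
  | beta _ _ h₁ h₂ => intro f; rw [rename_S_single]; exact .beta (h₁ _) (h₂ f)

theorem Par.S {t t' : DTerm} (h : Par t t') : ∀ {s s' : ℕ → DTerm}, (∀ i, Par (s i) (s' i)) →
    Par (S t s) (S t' s') := by
  have lift : ∀ {s s' : ℕ → DTerm}, (∀ i, Par (s i) (s' i)) →
      ∀ i, Par (liftSubst s i) (liftSubst s' i) := by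
    intro s s' h i
    cases i with
    | zero => exact .var 0
    | succ i => exact (h i).rename _
  induction h with
  | const c => intros; exact .const c
  | fvar x => intros; exact .fvar x
  | var i => intro s s' h; exact h i
  | app _ _ h₁ h₂ => intro s s' h; exact .app (h₁ h) (h₂ h)
  | lam _ ih => intro s s' h; exact .lam (ih (lift h))
  | beta _ _ h₁ h₂ => intro s s' h; rw [S_single_S]; exact .beta (h₁ (lift h)) (h₂ h)

theorem Par.contractum {t t' a a' : DTerm} (h : Par t t') (ha : Par a a') :
    Par (DTerm.S t (single a)) (DTerm.S t' (single a')) := by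
  refine h.S fun i => ?_
  cases i with
  | zero => exact ha
  | succ i => exact .var i

theorem Beta.par {t t' : DTerm} (h : Beta t t') : Par t t' := by
  induction h with
  | contract t₁ t₂ => exact .beta (.refl _) (.refl _)
  | appLeft t₂ _ ih => exact .app ih (.refl _)
  | appRight t₁ _ ih => exact .app (.refl _) ih
  | lam _ ih => exact .lam ih

theorem Par.reduces {t t' : DTerm} (h : Par t t') : BetaReduces t t' := by
  induction h with
  | const c => exact .refl _
  | fvar x => exact .refl _
  | var i => exact .refl _
  | app _ _ h₁ h₂ => exact h₁.app h₂
  | lam _ ih => exact ih.lam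
  | beta _ _ h₁ h₂ => exact (h₁.lam.app h₂).tail (.contract _ _)

/-! ### Head evaluation with a cost -/

/-- `Eval w n t v`: head evaluation of `t` contracts `n` redexes and ends in `v`. In weak mode
(`w = true`) evaluation stops at an abstraction, otherwise it goes on under it. -/
inductive Eval : Bool → ℕ → DTerm → DTerm → Prop
  | atom (w : Bool) {t : DTerm} : t.IsAtom → Eval w 0 t t
  | weakLam (t : DTerm) : Eval true 0 (lam t) (lam t)
  | strongLam {n : ℕ} {t v : DTerm} : Eval false n t v → Eval false n (lam t) (lam v)
  | beta {w : Bool} {a b : ℕ} {t b' u v : DTerm} : Eval true a t (lam b') →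
      Eval w b (S b' (single u)) v → Eval w (a + b + 1) (app t u) v
  | neutral (w : Bool) {n : ℕ} {t v : DTerm} (u : DTerm) : Eval true n t v → Neutral v →
      Eval w n (app t u) (app v u)

theorem Eval.reduces {w : Bool} {n : ℕ} {t v : DTerm} (h : Eval w n t v) :
    BetaReduces t v := by
  induction h with
  | atom => exact .refl _
  | weakLam => exact .refl _
  | strongLam _ ih => exact ih.lam
  | beta _ _ h₁ h₂ => exact ((h₁.app (.refl _)).tail (.contract _ _)).trans h₂
  | neutral w u _ _ ih => exact ih.app (.refl _)

theorem Eval.hnf {w : Bool} {n : ℕ} {t v : DTerm} (h : Eval w n t v) (hw : w = false) :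
    HNF v := by
  induction h with
  | atom _ h => exact .neutral (.atom h)
  | weakLam => exact absurd hw (by decide)
  | strongLam _ ih => exact .lam (ih hw)
  | beta _ _ _ h₂ => exact h₂ hw
  | neutral w u _ hv _ => exact .neutral (.app _ hv)

theorem Par.atom_inv {t t' : DTerm} (h : Par t t') (ht : t.IsAtom) : t' = t := by
  cases h <;> first | rfl | exact ht.elim

theorem Eval.atom_inv {w : Bool} {n : ℕ} {t v : DTerm} (h : Eval w n t v) (ht : t.IsAtom) :
    v = t := by
  cases h <;> first | rfl | exact ht.elim

/-- Reducing a term beforehand does not make its evaluation longer. -/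
theorem Eval.par {w : Bool} {n : ℕ} {t v : DTerm} (h : Eval w n t v) :
    ∀ {t' : DTerm}, Par t t' → ∃ m ≤ n, ∃ v', Par v v' ∧ Eval w m t' v' := by
  induction h with
  | atom w ht =>
    intro t' h
    rw [h.atom_inv ht]
    exact ⟨0, le_rfl, _, .refl _, .atom w ht⟩
  | weakLam t =>
    intro t' h
    cases h with
    | lam h => exact ⟨0, le_rfl, _, .lam h, .weakLam _⟩
  | strongLam _ ih =>
    intro t' h
    cases h with
    | lam h =>
      obtain ⟨m, hm, v', hv, he⟩ := ih h
      exact ⟨m, hm, _, .lam hv, .strongLam he⟩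
  | beta h₁ _ ih₁ ih₂ =>
    intro t' h
    cases h with
    | app ht hu =>
      obtain ⟨m₁, hm₁, f, hf, he₁⟩ := ih₁ ht
      cases hf with
      | lam hb =>
        obtain ⟨m₂, hm₂, v', hv, he₂⟩ := ih₂ (hb.contractum hu)
        exact ⟨m₁ + m₂ + 1, by omega, v', hv, .beta he₁ he₂⟩
    | beta ht hu =>
      cases h₁ with
      | atom _ h => exact h.elim
      | weakLam _ =>
        obtain ⟨m₂, hm₂, v', hv, he₂⟩ := ih₂ (ht.contractum hu)
        exact ⟨m₂, by omega, v', hv, he₂⟩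
  | neutral w u h₁ hv ih =>
    intro t' h
    cases h with
    | app ht hu =>
      obtain ⟨m, hm, v', hv', he⟩ := ih ht
      exact ⟨m, hm, _, .app hv' hu, .neutral w _ he (hv.reduces hv'.reduces)⟩
    | beta ht hu =>
      cases h₁ with
      | atom _ h => exact h.elim
      | weakLam _ => exact (not_neutral_lam hv).elim

theorem Eval.of_reduces {w : Bool} {n : ℕ} {t t' v : DTerm} (h : Eval w n t v)
    (hr : BetaReduces t t') : ∃ m ≤ n, ∃ v', BetaReduces v v' ∧ Eval w m t' v' := by
  induction hr with
  | refl => exact ⟨n, le_rfl, v, .refl _, h⟩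
  | tail _ hb ih =>
    obtain ⟨m, hm, v', hv, he⟩ := ih
    obtain ⟨m', hm', v'', hv', he'⟩ := he.par hb.par
    exact ⟨m', hm'.trans hm, v'', hv.trans hv'.reduces, he'⟩

/-! ### Standard reductions -/

/-- One step of weak head reduction. -/
inductive Whr : DTerm → DTerm → Prop
  | contract (t u : DTerm) : Whr (app (lam t) u) (S t (single u))
  | app {t t' : DTerm} (u : DTerm) : Whr t t' → Whr (app t u) (app t' u)

theorem Whr.S {t t' : DTerm} (h : Whr t t') (s : ℕ → DTerm) : Whr (S t s) (S t' s) := by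
  induction h with
  | contract t u => rw [S_single_S]; exact .contract _ _
  | app u _ ih => exact .app _ ih

theorem whrs_S {t t' : DTerm} (h : Relation.ReflTransGen Whr t t') (s : ℕ → DTerm) :
    Relation.ReflTransGen Whr (S t s) (S t' s) :=
  h.lift (fun x => S x s) fun _ _ h => h.S s

theorem whrs_app {t t' : DTerm} (h : Relation.ReflTransGen Whr t t') (u : DTerm) :
    Relation.ReflTransGen Whr (app t u) (app t' u) :=
  h.lift (fun x => DTerm.app x u) fun _ _ h => h.app u

theorem Eval.whr {t t' : DTerm} (h : Whr t t') : ∀ {w : Bool} {n : ℕ} {v : DTerm},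
    Eval w n t' v → ∃ m, Eval w m t v := by
  induction h with
  | contract t u => intro w n v h; exact ⟨_, .beta (.weakLam t) h⟩
  | app u _ ih =>
    intro w n v h
    cases h with
    | atom _ h => exact h.elim
    | beta h₁ h₂ =>
      obtain ⟨m, hm⟩ := ih h₁
      exact ⟨_, .beta hm h₂⟩
    | neutral _ _ h₁ hv =>
      obtain ⟨m, hm⟩ := ih h₁
      exact ⟨_, .neutral _ _ hm hv⟩

theorem Eval.whrs {t t' : DTerm} (h : Relation.ReflTransGen Whr t t') {w : Bool} {n : ℕ}
    {v : DTerm} (he : Eval w n t' v) : ∃ m, Eval w m t v := by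
  induction h using Relation.ReflTransGen.head_induction_on with
  | refl => exact ⟨n, he⟩
  | head h _ ih =>
    obtain ⟨m, hm⟩ := ih
    exact hm.whr h

/-- Standard reduction, in Kashima's inductive form: weak head reduction exposes the top
constructor of the result, the immediate subterms follow by standard reductions. -/
inductive Standard : DTerm → DTerm → Prop
  | atom {t a : DTerm} : Relation.ReflTransGen Whr t a → a.IsAtom → Standard t a
  | app {t u u' v v' : DTerm} : Relation.ReflTransGen Whr t (app u v) → Standard u u' →
      Standard v v' → Standard t (app u' v')
  | lam {t u u' : DTerm} : Relation.ReflTransGen Whr t (lam u) → Standard u u' →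
      Standard t (lam u')

theorem Standard.refl (t : DTerm) : Standard t t := by
  induction t with
  | const c => exact .atom .refl trivial
  | fvar x => exact .atom .refl trivial
  | var i => exact .atom .refl trivial
  | app _ _ h₁ h₂ => exact .app .refl h₁ h₂
  | lam _ ih => exact .lam .refl ih

theorem Standard.whrs {t u v : DTerm} (h : Relation.ReflTransGen Whr t u) (hs : Standard u v) :
    Standard t v := by
  cases hs with
  | atom h' ha => exact .atom (h.trans h') ha
  | app h' h₁ h₂ => exact .app (h.trans h') h₁ h₂
  | lam h' h₁ => exact .lam (h.trans h') h₁

/-- For renamings, the substitution property of standard reduction has a separate proof,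
as the one for substitutions uses it under abstractions. -/
theorem Standard.rename {t t' : DTerm} (h : Standard t t') : ∀ f,
    Standard (rename t f) (rename t' f) := by
  induction h with
  | @atom t a h ha =>
    intro f
    have e := whrs_S h fun i => var (f i)
    rw [← rename_eq_S, ← rename_eq_S] at e
    exact .whrs e (.refl _)
  | app h _ _ h₁ h₂ =>
    intro f
    have e := whrs_S h fun i => var (f i)
    rw [← rename_eq_S, ← rename_eq_S] at e
    exact .app e (h₁ f) (h₂ f)
  | lam h _ ih =>
    intro f
    have e := whrs_S h fun i => var (f i)
    rw [← rename_eq_S, ← rename_eq_S] at e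
    exact .lam e (ih _)

theorem Standard.S {t t' : DTerm} (h : Standard t t') : ∀ {s s' : ℕ → DTerm},
    (∀ i, Standard (s i) (s' i)) → Standard (S t s) (S t' s') := by
  induction h with
  | @atom t a h ha =>
    intro s s' hs
    refine .whrs (whrs_S h s) ?_
    cases a with
    | const c => exact .refl _
    | fvar x => exact .refl _
    | var i => exact hs i
    | app _ _ => exact ha.elim
    | lam _ => exact ha.elim
  | app h _ _ h₁ h₂ => intro s s' hs; exact .app (whrs_S h s) (h₁ hs) (h₂ hs)
  | lam h _ ih =>
    intro s s' hs
    refine .lam (whrs_S h s) (ih fun i => ?_)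
    cases i with
    | zero => exact .refl _
    | succ i => exact (hs i).rename _

theorem Standard.beta {u v : DTerm} (h : Beta u v) : ∀ {t : DTerm}, Standard t u →
    Standard t v := by
  induction h with
  | contract b a =>
    intro t hs
    cases hs with
    | atom _ ha => exact ha.elim
    | app h hf ha =>
      cases hf with
      | atom _ ha => exact ha.elim
      | lam h' hb =>
        refine .whrs ((h.trans (whrs_app h' _)).tail (.contract _ _)) (hb.S fun i => ?_)
        cases i with
        | zero => exact ha
        | succ i => exact .refl _
  | appLeft a _ ih =>
    intro t hs
    cases hs with
    | atom _ ha => exact ha.elim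
    | app h hf ha => exact .app h (ih hf) ha
  | appRight f _ ih =>
    intro t hs
    cases hs with
    | atom _ ha => exact ha.elim
    | app h hf ha => exact .app h hf (ih ha)
  | lam _ ih =>
    intro t hs
    cases hs with
    | atom _ ha => exact ha.elim
    | lam h hb => exact .lam h (ih hb)

theorem BetaReduces.standard {t u : DTerm} (h : BetaReduces t u) : Standard t u := by
  induction h with
  | refl => exact .refl _
  | tail _ h ih => exact ih.beta h

theorem Neutral.exists_eval {u : DTerm} (hu : Neutral u) : ∀ {t : DTerm}, Standard t u →
    ∀ w, ∃ n v, Eval w n t v ∧ Neutral v := by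
  induction hu with
  | @atom a ha =>
    intro t hs w
    cases hs with
    | atom h _ =>
      obtain ⟨n, hn⟩ := Eval.whrs h (.atom w ha)
      exact ⟨n, _, hn, .atom ha⟩
    | app _ _ _ => exact ha.elim
    | lam _ _ => exact ha.elim
  | app a _ ih =>
    intro t hs w
    cases hs with
    | atom _ ha => exact ha.elim
    | app h hf _ =>
      obtain ⟨n, v, hn, hv⟩ := ih hf true
      obtain ⟨m, hm⟩ := Eval.whrs h (.neutral w _ hn hv)
      exact ⟨m, _, hm, .app _ hv⟩

theorem HNF.exists_eval {u : DTerm} (hu : HNF u) : ∀ {t : DTerm}, Standard t u →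
    ∃ n v, Eval false n t v := by
  induction hu with
  | neutral hu =>
    intro t hs
    obtain ⟨n, v, hn, _⟩ := hu.exists_eval hs false
    exact ⟨n, v, hn⟩
  | lam _ ih =>
    intro t hs
    cases hs with
    | atom _ ha => exact ha.elim
    | lam h hb =>
      obtain ⟨n, v, hn⟩ := ih hb
      obtain ⟨m, hm⟩ := Eval.whrs h (.strongLam hn)
      exact ⟨m, _, hm⟩

/-- Head evaluation finds a head normal form whenever there is one. -/
theorem IsHNFOf.exists_eval {s t : DTerm} (h : IsHNFOf s t) : ∃ n v, Eval false n t v :=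
  h.2.hnf.exists_eval h.1.standard

end DTerm

open DTerm Filter

/-! ### Representations in the store -/

theorem Represents.unique {h : Heap} {p : Loc} {t : DTerm} (ht : Represents h p t) :
    ∀ {u : DTerm}, Represents h p u → u = t := by
  induction ht with
  | const e => intro u hu; cases hu <;> simp_all
  | fv e => intro u hu; cases hu <;> simp_all
  | bv e => intro u hu; cases hu <;> simp_all
  | ptr e _ ih =>
    intro u hu
    cases hu with
    | ptr e' h' =>
      have := e.symm.trans e'
      simp only [Option.some.injEq, RawTerm.ptr.injEq] at this
      exact ih (this ▸ h')
    | _ => simp_all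
  | app e _ _ ih₁ ih₂ =>
    intro u hu
    cases hu with
    | app e' h₁ h₂ =>
      have := e.symm.trans e'
      simp only [Option.some.injEq, RawTerm.app.injEq] at this
      obtain ⟨rfl, rfl⟩ := this
      rw [ih₁ h₁, ih₂ h₂]
    | _ => simp_all
  | lam e _ ih =>
    intro u hu
    cases hu with
    | lam e' h' =>
      have := e.symm.trans e'
      simp only [Option.some.injEq, RawTerm.lam.injEq] at this
      subst this
      rw [ih h']
    | _ => simp_all

theorem Represents.read_isSome {h : Heap} {p : Loc} {t : DTerm} (ht : Represents h p t) :
    ∃ r, h.read p = some r := by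
  cases ht <;> exact ⟨_, by assumption⟩

theorem Represents.lt_length {h : Heap} {p : Loc} {t : DTerm} (ht : Represents h p t) :
    p < h.length := by
  obtain ⟨r, hr⟩ := ht.read_isSome
  exact (List.getElem?_eq_some_iff.1 hr).1

/-- A representation is a well-founded graph. -/
theorem Represents.acc {h : Heap} {p : Loc} {t : DTerm} (ht : Represents h p t) :
    Acc (fun y x => h.Edge x y) p := by
  induction ht with
  | const e => exact ⟨_, fun y ⟨r, hr, hy⟩ => by simp_all [RawTerm.refs]⟩
  | fv e => exact ⟨_, fun y ⟨r, hr, hy⟩ => by simp_all [RawTerm.refs]⟩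
  | bv e =>
    refine ⟨_, fun y ⟨r, hr, hy⟩ => ?_⟩
    obtain rfl := Option.some.inj (e.symm.trans hr)
    simp [RawTerm.refs] at hy
  | ptr e _ ih =>
    refine ⟨_, fun y ⟨r, hr, hy⟩ => ?_⟩
    obtain rfl := Option.some.inj (e.symm.trans hr)
    simp only [RawTerm.refs, List.mem_singleton] at hy
    exact hy ▸ ih
  | app e _ _ ih₁ ih₂ =>
    refine ⟨_, fun y ⟨r, hr, hy⟩ => ?_⟩
    obtain rfl := Option.some.inj (e.symm.trans hr)
    simp only [RawTerm.refs, List.mem_cons, List.not_mem_nil, or_false] at hy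
    rcases hy with rfl | rfl
    · exact ih₁
    · exact ih₂
  | lam e _ ih =>
    refine ⟨_, fun y ⟨r, hr, hy⟩ => ?_⟩
    obtain rfl := Option.some.inj (e.symm.trans hr)
    simp only [RawTerm.refs, List.mem_singleton] at hy
    exact hy ▸ ih

theorem Represents.not_transGen {h : Heap} {p : Loc} {t : DTerm} (ht : Represents h p t) :
    ¬ Relation.TransGen h.Edge p p := by
  intro hc
  have irrefl : ∀ x, Acc (Relation.TransGen fun y x => h.Edge x y) x →
      ¬ Relation.TransGen (fun y x => h.Edge x y) x x := by
    intro x hx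
    induction hx with
    | intro x _ ih => intro hl; exact ih x hl hl
  exact irrefl p ht.acc.transGen (Relation.transGen_swap.2 hc)

theorem Represents.of_edge {h : Heap} {p q : Loc} {t : DTerm} (ht : Represents h p t)
    (he : h.Edge p q) : ∃ u, Represents h q u := by
  obtain ⟨r, hr, hq⟩ := he
  cases ht with
  | const e => obtain rfl := Option.some.inj (e.symm.trans hr); simp [RawTerm.refs] at hq
  | fv e => obtain rfl := Option.some.inj (e.symm.trans hr); simp [RawTerm.refs] at hq
  | bv e => obtain rfl := Option.some.inj (e.symm.trans hr); simp [RawTerm.refs] at hq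
  | ptr e hu =>
    obtain rfl := Option.some.inj (e.symm.trans hr)
    simp only [RawTerm.refs, List.mem_singleton] at hq
    exact ⟨_, hq ▸ hu⟩
  | app e h₁ h₂ =>
    obtain rfl := Option.some.inj (e.symm.trans hr)
    simp only [RawTerm.refs, List.mem_cons, List.not_mem_nil, or_false] at hq
    rcases hq with rfl | rfl
    · exact ⟨_, h₁⟩
    · exact ⟨_, h₂⟩
  | lam e hu =>
    obtain rfl := Option.some.inj (e.symm.trans hr)
    simp only [RawTerm.refs, List.mem_singleton] at hq
    exact ⟨_, hq ▸ hu⟩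

theorem Represents.of_reachable {h : Heap} {p q : Loc} {t : DTerm} (ht : Represents h p t)
    (hr : Relation.ReflTransGen h.Edge p q) : ∃ u, Represents h q u := by
  induction hr with
  | refl => exact ⟨t, ht⟩
  | tail _ he ih =>
    obtain ⟨u, hu⟩ := ih
    exact hu.of_edge he

theorem edge_ptr {h : Heap} {p q : Loc} (e : h.read p = some (.ptr q)) : h.Edge p q :=
  ⟨_, e, by simp [RawTerm.refs]⟩

theorem edge_lam {h : Heap} {p q : Loc} (e : h.read p = some (.lam q)) : h.Edge p q :=
  ⟨_, e, by simp [RawTerm.refs]⟩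

theorem edge_app_left {h : Heap} {p q₁ q₂ : Loc} (e : h.read p = some (.app q₁ q₂)) :
    h.Edge p q₁ := ⟨_, e, by simp [RawTerm.refs]⟩

theorem edge_app_right {h : Heap} {p q₁ q₂ : Loc} (e : h.read p = some (.app q₁ q₂)) :
    h.Edge p q₂ := ⟨_, e, by simp [RawTerm.refs]⟩

/-- A representation depends only on the cells of a closed set that contains its root. -/
theorem Represents.congr {h h' : Heap} {X : Set Loc}
    (hX : ∀ {x y}, x ∈ X → h.Edge x y → y ∈ X) (e : ∀ x ∈ X, x < h.length → h'.read x = h.read x)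
    {p : Loc} {t : DTerm} (ht : Represents h p t) : p ∈ X → Represents h' p t := by
  have key : ∀ {x r}, x ∈ X → h.read x = some r → h'.read x = some r := by
    intro x r hx hr
    rw [e x hx (List.getElem?_eq_some_iff.1 hr).1, hr]
  induction ht with
  | const hr => intro hp; exact .const (key hp hr)
  | fv hr => intro hp; exact .fv (key hp hr)
  | bv hr => intro hp; exact .bv (key hp hr)
  | ptr hr _ ih => intro hp; exact .ptr (key hp hr) (ih (hX hp (edge_ptr hr)))
  | app hr _ _ ih₁ ih₂ =>
    intro hp
    exact .app (key hp hr) (ih₁ (hX hp (edge_app_left hr))) (ih₂ (hX hp (edge_app_right hr)))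
  | lam hr _ ih => intro hp; exact .lam (key hp hr) (ih (hX hp (edge_lam hr)))

theorem read_of_prefix {h h' : Heap} (hh : h <+: h') {x : Loc} (hx : x < h.length) :
    h'.read x = h.read x := by
  obtain ⟨l, rfl⟩ := hh
  exact List.getElem?_append_left hx

theorem Represents.of_prefix {h h' : Heap} (hh : h <+: h') {p : Loc} {t : DTerm}
    (ht : Represents h p t) : Represents h' p t :=
  ht.congr (X := Set.univ) (fun _ _ => trivial) (fun _ _ hx => read_of_prefix hh hx) trivial

/-! ### Working areas and the evolution of the store -/

/-- `X` is a working area in the store `h`: it contains all cells still to be allocated, its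
allocated cells hold representations, and no edge leaves it. As future cells belong to `X`,
one and the same set serves for a whole computation. -/
structure Heap.Good (h : Heap) (X : Set Loc) : Prop where
  fresh : ∀ x, h.length ≤ x → x ∈ X
  represents : ∀ x ∈ X, x < h.length → ∃ t, Represents h x t
  edge : ∀ {x y}, x ∈ X → h.Edge x y → y ∈ X

/-- The store `h` may evolve into `h'` by a computation with working area `X`: cells outside `X`
stay as they are, and all represented terms are preserved up to `β`-reduction. -/
structure Heap.Step (X : Set Loc) (h h' : Heap) : Prop where
  length_le : h.length ≤ h'.length
  frame : ∀ x, x ∉ X → h'.read x = h.read x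
  reduces : ∀ {x t}, Represents h x t → ∃ t', BetaReduces t t' ∧ Represents h' x t'

theorem Heap.Step.trans {X : Set Loc} {h₁ h₂ h₃ : Heap} (s : Heap.Step X h₁ h₂)
    (s' : Heap.Step X h₂ h₃) : Heap.Step X h₁ h₃ where
  length_le := s.length_le.trans s'.length_le
  frame x hx := (s'.frame x hx).trans (s.frame x hx)
  reduces hr := by
    obtain ⟨t', h₁, h₂⟩ := s.reduces hr
    obtain ⟨t'', h₃, h₄⟩ := s'.reduces h₂
    exact ⟨t'', h₁.trans h₃, h₄⟩

theorem Heap.Good.step_of_prefix {X : Set Loc} {h h' : Heap} (g : h.Good X) (hh : h <+: h') :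
    Heap.Step X h h' where
  length_le := hh.length_le
  frame x hx := read_of_prefix hh (not_le.1 fun hl => hx (g.fresh x hl))
  reduces hr := ⟨_, .refl _, hr.of_prefix hh⟩

theorem Heap.Good.step_refl {X : Set Loc} {h : Heap} (g : h.Good X) : Heap.Step X h h :=
  g.step_of_prefix List.prefix_rfl

theorem Heap.Good.of_reachable {X : Set Loc} {h : Heap} (g : h.Good X) {p q : Loc}
    (hp : p ∈ X) (hr : Relation.ReflTransGen h.Edge p q) : q ∈ X := by
  induction hr with
  | refl => exact hp
  | tail _ he ih => exact g.edge ih he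

theorem prefix_alloc (h : Heap) (r : RawTerm) : h <+: h ++ [r] := List.prefix_append h [r]

theorem read_alloc (h : Heap) (r : RawTerm) : Heap.read (h ++ [r]) h.length = some r := by
  simp [Heap.read]

theorem eq_length_of_lt_alloc {h : Heap} {r : RawTerm} {x : ℕ}
    (hl : x < (h ++ [r] : Heap).length) (hx : h.length ≤ x) : x = h.length := by
  rw [List.length_append, List.length_singleton] at hl
  omega

theorem Heap.Good.alloc {X : Set Loc} {h : Heap} (g : h.Good X) {r : RawTerm} {t : DTerm}
    (hr : ∀ q ∈ r.refs, q ∈ X) (ht : Represents (h ++ [r]) h.length t) :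
    Heap.Good (h ++ [r]) X where
  fresh x hx := g.fresh x ((prefix_alloc h r).length_le.trans hx)
  represents x hx hl := by
    rcases lt_or_ge x h.length with hl' | hl'
    · obtain ⟨u, hu⟩ := g.represents x hx hl'
      exact ⟨u, hu.of_prefix (prefix_alloc h r)⟩
    · have : x = h.length := eq_length_of_lt_alloc hl hl'
      exact ⟨t, this ▸ ht⟩
  edge {x y} hx := by
    rintro ⟨r', hr', hy⟩
    rcases lt_or_ge x h.length with hl | hl
    · rw [read_of_prefix (prefix_alloc h r) hl] at hr'
      exact g.edge hx ⟨r', hr', hy⟩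
    · have hl' := (List.getElem?_eq_some_iff.1 hr').1
      have : x = h.length := eq_length_of_lt_alloc hl' hl
      rw [this, read_alloc] at hr'
      exact hr y (Option.some.inj hr' ▸ hy)

/-- A computation with a smaller working area is one with the larger area. -/
theorem Heap.Step.mono {X Y : Set Loc} {h h' : Heap} (hX : h.Good X) (hY : h'.Good Y)
    (s : Heap.Step Y h h') (hYX : Y ⊆ X) : Heap.Step X h h' ∧ h'.Good X := by
  refine ⟨⟨s.length_le, fun x hx => s.frame x fun hy => hx (hYX hy), s.reduces⟩, ?_, ?_, ?_⟩
  · exact fun x hx => hX.fresh x (s.length_le.trans hx)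
  · intro x hx hl
    by_cases hy : x ∈ Y
    · exact hY.represents x hy hl
    · have hl' : x < h.length := by
        obtain ⟨r, hr⟩ : ∃ r, h'.read x = some r := ⟨_, List.getElem?_eq_getElem hl⟩
        rw [s.frame x hy] at hr
        exact (List.getElem?_eq_some_iff.1 hr).1
      obtain ⟨t, ht⟩ := hX.represents x hx hl'
      obtain ⟨t', _, ht'⟩ := s.reduces ht
      exact ⟨t', ht'⟩
  · rintro x y hx ⟨r, hr, hy⟩
    by_cases hxY : x ∈ Y
    · exact hYX (hY.edge hxY ⟨r, hr, hy⟩)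
    · rw [s.frame x hxY] at hr
      exact hX.edge hx ⟨r, hr, hy⟩

/-- The working area strictly below `p`. -/
def Heap.below (h : Heap) (p : Loc) : Set Loc :=
  {x | Relation.TransGen h.Edge p x ∨ h.length ≤ x}

theorem Heap.Good.below {X : Set Loc} {h : Heap} (g : h.Good X) {p : Loc} {t : DTerm}
    (hp : p ∈ X) (ht : Represents h p t) :
    h.Good (h.below p) ∧ h.below p ⊆ X ∧ p ∉ h.below p := by
  have sub : h.below p ⊆ X := by
    rintro x (hx | hx)
    · exact g.of_reachable hp hx.to_reflTransGen
    · exact g.fresh x hx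
  refine ⟨⟨fun x hx => .inr hx, fun x hx hl => g.represents x (sub hx) hl, ?_⟩, sub, ?_⟩
  · rintro x y (hx | hx) he
    · exact .inl (hx.tail he)
    · obtain ⟨r, hr, _⟩ := he
      exact absurd (List.getElem?_eq_some_iff.1 hr).1 (not_lt.2 hx)
  · rintro (hc | hl)
    · exact ht.not_transGen hc
    · exact absurd ht.lt_length (not_lt.2 hl)

theorem read_write_ne {h : Heap} {p x : Loc} (r : RawTerm) (hx : x ≠ p) :
    (h.write p r).read x = h.read x := by
  simp only [Heap.read, Heap.write]
  exact List.getElem?_set_ne hx.symm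

theorem read_write_self {h : Heap} {p : Loc} (r : RawTerm) (hp : p < h.length) :
    (h.write p r).read p = some r := by
  simp [Heap.read, Heap.write, hp]

/-- Updating `p` by an indirection to the result `r` of a computation that worked strictly
below `p`. No cycle arises, since `r` lies in a closed area without `p`. -/
theorem Heap.Step.write {X Y : Set Loc} {h h' : Heap} {p r : Loc} {t u : DTerm}
    (hX : h.Good X) (hY : h'.Good Y) (s : Heap.Step Y h h') (hYX : Y ⊆ X) (hpX : p ∈ X)
    (hpY : p ∉ Y) (ht : Represents h p t) (hr : r ∈ Y) (hu : Represents h' r u)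
    (htu : BetaReduces t u) :
    Heap.Step X h (h'.write p (.ptr r)) ∧ (h'.write p (.ptr r)).Good X ∧
      Represents (h'.write p (.ptr r)) p u ∧
      ∀ x ∈ Y, ∀ v, Represents h' x v → Represents (h'.write p (.ptr r)) x v := by
  have hlen : (h'.write p (.ptr r)).length = h'.length := List.length_set
  have hp' : p < h'.length := ht.lt_length.trans_le s.length_le
  have same : ∀ x, x ≠ p → (h'.write p (.ptr r)).read x = h'.read x :=
    fun x hx => read_write_ne _ hx
  have old : ∀ x ∈ Y, ∀ v, Represents h' x v → Represents (h'.write p (.ptr r)) x v := by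
    intro x hx v hv
    exact hv.congr hY.edge (fun y hy _ => same y fun e => hpY (e ▸ hy)) hx
  have hpu : Represents (h'.write p (.ptr r)) p u :=
    .ptr (read_write_self _ hp') (old r hr u hu)
  have red : ∀ {x v}, Represents h x v →
      ∃ v', BetaReduces v v' ∧ Represents (h'.write p (.ptr r)) x v' := by
    intro x v hv
    have base : ∀ {x v}, Represents h x v → (x = p ∨ x ∈ Y) →
        ∃ v', BetaReduces v v' ∧ Represents (h'.write p (.ptr r)) x v' := by
      rintro x v hv (rfl | hx)
      · exact ⟨u, ht.unique hv ▸ htu, hpu⟩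
      · obtain ⟨v', h₁, h₂⟩ := s.reduces hv
        exact ⟨v', h₁, old x hx v' h₂⟩
    have keep : ∀ {x r'}, ¬ (x = p ∨ x ∈ Y) → h.read x = some r' →
        (h'.write p (.ptr r)).read x = some r' := by
      intro x r' hx hr'
      rw [same x fun e => hx (.inl e), s.frame x fun e => hx (.inr e), hr']
    induction hv with
    | @const x c e =>
      by_cases hx : x = p ∨ x ∈ Y
      · exact base (.const e) hx
      · exact ⟨_, .refl _, .const (keep hx e)⟩
    | @fv x c e =>
      by_cases hx : x = p ∨ x ∈ Y
      · exact base (.fv e) hx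
      · exact ⟨_, .refl _, .fv (keep hx e)⟩
    | @bv x c e =>
      by_cases hx : x = p ∨ x ∈ Y
      · exact base (.bv e) hx
      · exact ⟨_, .refl _, .bv (keep hx e)⟩
    | @ptr x q v e hq ih =>
      by_cases hx : x = p ∨ x ∈ Y
      · exact base (.ptr e hq) hx
      · obtain ⟨v', h₁, h₂⟩ := ih
        exact ⟨v', h₁, .ptr (keep hx e) h₂⟩
    | @app x q₁ q₂ v₁ v₂ e hq₁ hq₂ ih₁ ih₂ =>
      by_cases hx : x = p ∨ x ∈ Y
      · exact base (.app e hq₁ hq₂) hx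
      · obtain ⟨v₁', h₁, h₁'⟩ := ih₁
        obtain ⟨v₂', h₂, h₂'⟩ := ih₂
        exact ⟨_, h₁.app h₂, .app (keep hx e) h₁' h₂'⟩
    | @lam x q v e hq ih =>
      by_cases hx : x = p ∨ x ∈ Y
      · exact base (.lam e hq) hx
      · obtain ⟨v', h₁, h₂⟩ := ih
        exact ⟨_, h₁.lam, .lam (keep hx e) h₂⟩
  obtain ⟨sX, gX⟩ := s.mono hX hY hYX
  refine ⟨⟨s.length_le.trans hlen.ge, ?_, red⟩, ⟨?_, ?_, ?_⟩, hpu, old⟩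
  · intro x hx
    rw [same x fun e => hx (e ▸ hpX), sX.frame x hx]
  · exact fun x hx => gX.fresh x (hlen.ge.trans hx)
  · intro x hx hl
    by_cases hxY : x ∈ Y
    · obtain ⟨v, hv⟩ := hY.represents x hxY (hlen ▸ hl)
      exact ⟨v, old x hxY v hv⟩
    · have hl' : x < h.length := by
        by_contra hc
        obtain ⟨r', hr'⟩ : ∃ r', h'.read x = some r' :=
          ⟨_, List.getElem?_eq_getElem (hlen ▸ hl)⟩
        rw [s.frame x hxY] at hr'
        exact hc (List.getElem?_eq_some_iff.1 hr').1
      obtain ⟨v, hv⟩ := hX.represents x hx hl'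
      obtain ⟨v', _, hv'⟩ := red hv
      exact ⟨v', hv'⟩
  · rintro x y hx ⟨r', hr', hy⟩
    by_cases hxp : x = p
    · subst hxp
      rw [read_write_self _ hp'] at hr'
      obtain rfl := Option.some.inj hr'
      simp only [RawTerm.refs, List.mem_singleton] at hy
      exact hYX (hy ▸ hr)
    · rw [same x hxp] at hr'
      exact gX.edge hx ⟨r', hr', hy⟩

/-! ### Environments -/

/-- `EnvRep h X d e nl σ`: the environment `e` with embedding level `nl` denotes the substitution
`σ` in the store `h`, all its references lie in `X`, and its closures are nested at most `d`
deep. In the items that arise in computations, the level `l` of a closure is its `nl`; a closure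
is brought from its level `n` to the level `nl` by a shift of the indices. -/
inductive EnvRep (h : Heap) (X : Set Loc) : ℕ → Env → ℕ → (ℕ → DTerm) → Prop
  | nil (d nl : ℕ) : EnvRep h X d [] nl (fun i => .var (i + nl))
  | dum {d : ℕ} {e : Env} {nl : ℕ} {σ : ℕ → DTerm} {l : ℕ} : l < nl → EnvRep h X d e nl σ →
      EnvRep h X d (.dum l :: e) nl (scons (.var (nl - l - 1)) σ)
  | bndg {d : ℕ} {e e' : Env} {nl n : ℕ} {σ σ' : ℕ → DTerm} {p : Loc} {t : DTerm} :
      p ∈ X → Represents h p t → EnvRep h X d e' n σ' → n ≤ nl → EnvRep h X (d + 1) e nl σ →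
      EnvRep h X (d + 1) (.bndg p e'.length n e' n :: e) nl
        (scons (rename (S t σ') (fun i => i + (nl - n))) σ)

namespace EnvRep

theorem nil_inv {h : Heap} {X : Set Loc} {d nl : ℕ} {σ : ℕ → DTerm}
    (he : EnvRep h X d [] nl σ) : σ = fun i => .var (i + nl) := by
  cases he
  rfl

theorem mono_depth {h : Heap} {X : Set Loc} {d : ℕ} {e : Env} {nl : ℕ} {σ : ℕ → DTerm}
    (he : EnvRep h X d e nl σ) : ∀ {d' : ℕ}, d ≤ d' → EnvRep h X d' e nl σ := by
  induction he with
  | nil d nl => intro d' _; exact .nil d' nl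
  | dum hl _ ih => intro d' hd; exact .dum hl (ih hd)
  | bndg hp ht _ hn _ ih₁ ih₂ =>
    intro d' hd
    obtain ⟨d'', rfl⟩ := Nat.exists_eq_add_of_le' (Nat.one_le_of_lt hd)
    exact .bndg hp ht (ih₁ (by omega)) hn (ih₂ hd)

theorem mono_set {h : Heap} {X Y : Set Loc} (hXY : X ⊆ Y) {d : ℕ} {e : Env} {nl : ℕ}
    {σ : ℕ → DTerm} (he : EnvRep h X d e nl σ) : EnvRep h Y d e nl σ := by
  induction he with
  | nil d nl => exact .nil d nl
  | dum hl _ ih => exact .dum hl ih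
  | bndg hp ht _ hn _ ih₁ ih₂ => exact .bndg (hXY hp) ht ih₁ hn ih₂

theorem congr {h h' : Heap} {X : Set Loc}
    (hr : ∀ x ∈ X, ∀ t, Represents h x t → Represents h' x t) {d : ℕ} {e : Env}
    {nl : ℕ} {σ : ℕ → DTerm} (he : EnvRep h X d e nl σ) : EnvRep h' X d e nl σ := by
  induction he with
  | nil d nl => exact .nil d nl
  | dum hl _ ih => exact .dum hl ih
  | bndg hp ht _ hn _ ih₁ ih₂ => exact .bndg hp (hr _ hp _ ht) ih₁ hn ih₂

theorem of_prefix {h h' : Heap} (hh : h <+: h') {X : Set Loc} {d : ℕ} {e : Env} {nl : ℕ}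
    {σ : ℕ → DTerm} (he : EnvRep h X d e nl σ) : EnvRep h' X d e nl σ :=
  he.congr fun _ _ _ ht => ht.of_prefix hh

theorem step {h h' : Heap} {X Y : Set Loc} (s : Heap.Step Y h h') {d : ℕ} {e : Env} {nl : ℕ}
    {σ : ℕ → DTerm} (he : EnvRep h X d e nl σ) :
    ∃ σ', (∀ i, BetaReduces (σ i) (σ' i)) ∧ EnvRep h' X d e nl σ' := by
  have cons : ∀ {a b : DTerm} {s s' : ℕ → DTerm}, BetaReduces a b →
      (∀ i, BetaReduces (s i) (s' i)) → ∀ i, BetaReduces (scons a s i) (scons b s' i) := by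
    intro a b s s' h₁ h₂ i
    cases i with
    | zero => exact h₁
    | succ i => exact h₂ i
  induction he with
  | nil d nl => exact ⟨_, fun _ => .refl _, .nil d nl⟩
  | dum hl _ ih =>
    obtain ⟨σ', h₁, h₂⟩ := ih
    exact ⟨_, cons (.refl _) h₁, .dum hl h₂⟩
  | bndg hp ht _ hn _ ih₁ ih₂ =>
    obtain ⟨τ, h₁, h₁'⟩ := ih₁
    obtain ⟨σ', h₂, h₂'⟩ := ih₂
    obtain ⟨t', h₃, h₃'⟩ := s.reduces ht
    exact ⟨_, cons ((h₃.S h₁).rename _) h₂, .bndg hp h₃' h₁' hn h₂'⟩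

/-- Raising the embedding level shifts the denotation. -/
theorem shift {h : Heap} {X : Set Loc} {d : ℕ} {e : Env} {nl : ℕ} {σ : ℕ → DTerm}
    (he : EnvRep h X d e nl σ) (k : ℕ) :
    EnvRep h X d e (nl + k) (fun i => rename (σ i) (fun j => j + k)) := by
  have cons : ∀ (a : DTerm) (s : ℕ → DTerm) (f : ℕ → ℕ),
      (fun i => rename (scons a s i) f) = scons (rename a f) fun i => rename (s i) f := by
    intro a s f
    funext i
    cases i <;> rfl
  induction he with
  | nil d nl =>
    have e : (fun i => rename (.var (i + nl)) (fun j => j + k)) =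
        fun i => DTerm.var (i + (nl + k)) := by
      funext i
      simp only [rename, add_assoc]
    rw [e]
    exact .nil d _
  | @dum d e nl σ l hl _ ih =>
    rw [cons]
    have e : rename (.var (nl - l - 1)) (fun j => j + k) = .var (nl + k - l - 1) := by
      simp only [rename]
      congr 1
      omega
    rw [e]
    exact .dum (by omega) ih
  | @bndg d e e' nl n σ σ' p t hp ht h₁ hn _ _ ih₂ =>
    rw [cons, rename_rename]
    have e : (fun i => i + (nl - n) + k) = fun i => i + (nl + k - n) := by
      funext i
      omega
    rw [e]
    exact .bndg hp ht h₁ (by omega) ih₂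

/-- The environment for the body of an abstraction. -/
theorem lift {h : Heap} {X : Set Loc} {d : ℕ} {e : Env} {nl : ℕ} {σ : ℕ → DTerm}
    (he : EnvRep h X d e nl σ) : EnvRep h X d (.dum nl :: e) (nl + 1) (liftSubst σ) := by
  have e : liftSubst σ = scons (.var (nl + 1 - nl - 1)) fun i => rename (σ i) fun j => j + 1 := by
    funext i
    cases i with
    | zero => simp [liftSubst, scons]
    | succ i => rfl
  rw [e]
  exact .dum (by omega) (he.shift 1)

/-- The environment for the body of a contracted abstraction: its closure and that of the
argument are at the same level. -/
theorem bind {h : Heap} {X : Set Loc} {d d' : ℕ} {e e' : Env} {nl : ℕ} {σ σ' : ℕ → DTerm}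
    {p : Loc} {t : DTerm} (hp : p ∈ X) (ht : Represents h p t) (he' : EnvRep h X d' e' nl σ')
    (he : EnvRep h X d e nl σ) :
    EnvRep h X (max d d' + 1) (.bndg p e'.length nl e' nl :: e) nl (scons (S t σ') σ) := by
  have := EnvRep.bndg hp ht (he'.mono_depth (le_max_right d d')) le_rfl
    (he.mono_depth (d' := max d d' + 1) (by omega))
  rw [Nat.sub_self, rename_eq_S] at this
  exact (S_var (S t σ')) ▸ this

theorem of_length_le {h : Heap} {X : Set Loc} {d : ℕ} {e : Env} {nl : ℕ} {σ : ℕ → DTerm}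
    (he : EnvRep h X d e nl σ) :
    ∀ {i : ℕ}, e.length ≤ i → σ i = .var (i - e.length + nl) := by
  induction he with
  | nil d nl => intro i _; rfl
  | dum _ _ ih =>
    intro i hi
    cases i with
    | zero => simp at hi
    | succ i => simpa [scons] using ih (by simpa using hi)
  | bndg _ _ _ _ _ _ ih =>
    intro i hi
    cases i with
    | zero => simp at hi
    | succ i => simpa [scons] using ih (by simpa using hi)

theorem of_lt_length {h : Heap} {X : Set Loc} {d : ℕ} {e : Env} {nl : ℕ} {σ : ℕ → DTerm}
    (he : EnvRep h X d e nl σ) : ∀ {i : ℕ}, i < e.length →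
    (∃ l : ℕ, l < nl ∧ e[i]? = some (.dum l) ∧ σ i = .var (nl - l - 1)) ∨
    ∃ (d' : ℕ) (p : Loc) (t : DTerm) (e' : Env) (n : ℕ) (σ' : ℕ → DTerm), d = d' + 1 ∧
      e[i]? = some (.bndg p e'.length n e' n) ∧ p ∈ X ∧ Represents h p t ∧
      EnvRep h X d' e' nl σ' ∧ σ i = S t σ' := by
  induction he with
  | nil d nl => intro i hi; simp at hi
  | @dum d e nl σ l hl _ ih =>
    intro i hi
    cases i with
    | zero => exact .inl ⟨l, hl, rfl, rfl⟩
    | succ i => simpa [scons] using ih (by simpa using hi)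
  | @bndg d e e' nl n σ σ' p t hp ht he' hn _ _ ih =>
    intro i hi
    cases i with
    | zero =>
      refine .inr ⟨d, p, t, e', n, _, rfl, rfl, hp, ht, ?_, rename_S _ _ _⟩
      have := he'.shift (nl - n)
      rwa [Nat.add_sub_cancel' hn] at this
    | succ i => simpa only [scons, List.getElem?_cons_succ] using ih (by simpa using hi)

end EnvRep

theorem nth_eq_getElem? (e : Env) : ∀ i : ℕ, nth e ((i : ℤ) + 1) = e[i]? := by
  induction e with
  | nil => intro i; rfl
  | cons x e ih =>
    intro i
    cases i with
    | zero => simp [nth]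
    | succ i =>
      have : ¬ (i : ℤ) + 1 + 1 = 1 := by omega
      simp only [nth, Nat.cast_add, Nat.cast_one, if_neg this, add_sub_cancel_right, ih,
        List.getElem?_cons_succ]

/-! ### Indirections -/

theorem eventually_of_succ {P : ℕ → Prop} (h : ∀ᶠ k in atTop, P (k + 1)) :
    ∀ᶠ k in atTop, P k := by
  obtain ⟨n, hn⟩ := eventually_atTop.1 h
  refine eventually_atTop.2 ⟨n + 1, fun k hk => ?_⟩
  obtain ⟨j, rfl⟩ := Nat.exists_eq_add_of_le' (Nat.one_le_of_lt hk)
  exact hn j (by omega)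

/-- The end `g` of the `ptr` chain at `p`. -/
theorem Represents.exists_deref {h : Heap} {p : Loc} {t : DTerm} (ht : Represents h p t) :
    ∃ g, (∀ᶠ k in atTop, deref k h p = some g) ∧
      (∀ q, ∀ᶠ k in atTop, assign k h q p = some (h.write q (.ptr g))) ∧
      Represents h g t ∧ (∀ q, h.read g ≠ some (.ptr q)) ∧
      Relation.ReflTransGen h.Edge p g := by
  have here : ∀ {p r}, h.read p = some r → (∀ q, r ≠ .ptr q) →
      (∀ᶠ k in atTop, deref k h p = some p) ∧
      (∀ q, ∀ᶠ k in atTop, assign k h q p = some (h.write q (.ptr p))) ∧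
      (∀ q, h.read p ≠ some (.ptr q)) ∧ Relation.ReflTransGen h.Edge p p := by
    intro p r hr hn
    refine ⟨eventually_of_succ (.of_forall fun k => ?_),
      fun q => eventually_of_succ (.of_forall fun k => ?_), fun q => ?_, .refl⟩
    · cases r <;> simp_all [deref]
    · cases r <;> simp_all [assign]
    · rw [hr]
      simpa using hn q
  induction ht with
  | const e =>
    obtain ⟨h₁, h₂, h₃, h₄⟩ := here e (by simp)
    exact ⟨_, h₁, h₂, .const e, h₃, h₄⟩
  | fv e =>
    obtain ⟨h₁, h₂, h₃, h₄⟩ := here e (by simp)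
    exact ⟨_, h₁, h₂, .fv e, h₃, h₄⟩
  | bv e =>
    obtain ⟨h₁, h₂, h₃, h₄⟩ := here e (by simp)
    exact ⟨_, h₁, h₂, .bv e, h₃, h₄⟩
  | ptr e _ ih =>
    obtain ⟨g, h₁, h₂, h₃, h₄, h₅⟩ := ih
    refine ⟨g, eventually_of_succ ?_, fun q => eventually_of_succ ?_, h₃, h₄,
      .head (edge_ptr e) h₅⟩
    · filter_upwards [h₁] with k hk
      simpa [deref, e] using hk
    · filter_upwards [h₂ q] with k hk
      simpa [assign, e] using hk
  | app e r₁ r₂ _ _ =>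
    obtain ⟨h₁, h₂, h₃, h₄⟩ := here e (by simp)
    exact ⟨_, h₁, h₂, .app e r₁ r₂, h₃, h₄⟩
  | lam e r _ =>
    obtain ⟨h₁, h₂, h₃, h₄⟩ := here e (by simp)
    exact ⟨_, h₁, h₂, .lam e r, h₃, h₄⟩

theorem eventually_succ {P : ℕ → Prop} (h : ∀ᶠ k in atTop, P k) :
    ∀ᶠ k in atTop, P (k + 1) :=
  (tendsto_add_atTop_nat 1).eventually h

/-- A procedure that treats `ptr` cells by `deref` has the same outcome at a `ptr` cell `p` as at
the cell `q` to which `p` points, even if `q` is again a `ptr` cell. -/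
theorem eventually_of_ptr {α : Type} {F : ℕ → Loc → Option α} {h : Heap}
    (hF : ∀ k x y, h.read x = some (.ptr y) → F (k + 1) x = (deref k h y).bind (F k))
    {p q : Loc} (hp : h.read p = some (.ptr q)) {t : DTerm} (hq : Represents h q t) {a : α}
    (ha : ∀ᶠ k in atTop, F k q = some a) : ∀ᶠ k in atTop, F k p = some a := by
  obtain ⟨g, hg, -⟩ := hq.exists_deref
  have hga : ∀ᶠ k in atTop, F k g = some a := by
    by_cases hc : ∃ y, h.read q = some (.ptr y)
    · obtain ⟨y, hy⟩ := hc
      filter_upwards [eventually_succ ha, eventually_succ hg] with k h₁ h₂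
      have hd : deref k h y = some g := by simpa [deref, hy] using h₂
      rw [hF k q y hy, hd] at h₁
      exact h₁
    · obtain ⟨r, hr⟩ := hq.read_isSome
      have hgq : g = q := by
        obtain ⟨k, hk⟩ := (eventually_succ hg).exists
        cases r <;> simp_all [deref]
      exact hgq ▸ ha
  refine eventually_of_succ ?_
  filter_upwards [hga, hg] with k h₁ h₂
  rw [hF k p q hp, h₂]
  exact h₁

/-- A property of representations of `t` may be proved for cells other than `ptr` cells and then
transported backwards along indirections. -/
theorem Represents.ptr_induction {h : Heap} {P : Loc → Prop} {p : Loc} {t : DTerm}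
    (ht : Represents h p t)
    (cell : ∀ g, Represents h g t → (∀ q, h.read g ≠ some (.ptr q)) → P g)
    (ptr : ∀ p q, h.read p = some (.ptr q) → Represents h q t → P q → P p) : P p := by
  induction ht with
  | const e => exact cell _ (.const e) (by simp [e])
  | fv e => exact cell _ (.fv e) (by simp [e])
  | bv e => exact cell _ (.bv e) (by simp [e])
  | ptr e hq ih => exact ptr _ _ e hq (ih cell ptr)
  | app e h₁ h₂ _ _ => exact cell _ (.app e h₁ h₂) (by simp [e])
  | lam e h _ => exact cell _ (.lam e h) (by simp [e])

theorem Represents.const_inv {h : Heap} {p : Loc} {c : String}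
    (ht : Represents h p (.const c)) (hp : ∀ q, h.read p ≠ some (.ptr q)) :
    h.read p = some (.const c) := by
  cases ht with
  | const e => exact e
  | ptr e _ => exact absurd e (hp _)

theorem Represents.fvar_inv {h : Heap} {p : Loc} {x : String}
    (ht : Represents h p (.fvar x)) (hp : ∀ q, h.read p ≠ some (.ptr q)) :
    h.read p = some (.fv x) := by
  cases ht with
  | fv e => exact e
  | ptr e _ => exact absurd e (hp _)

theorem Represents.var_inv {h : Heap} {p : Loc} {i : ℕ}
    (ht : Represents h p (.var i)) (hp : ∀ q, h.read p ≠ some (.ptr q)) :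
    h.read p = some (.bv ((i : ℤ) + 1)) := by
  cases ht with
  | bv e => exact e
  | ptr e _ => exact absurd e (hp _)

theorem Represents.app_inv {h : Heap} {p : Loc} {t u : DTerm}
    (ht : Represents h p (.app t u)) (hp : ∀ q, h.read p ≠ some (.ptr q)) :
    ∃ p₁ p₂, h.read p = some (.app p₁ p₂) ∧ Represents h p₁ t ∧ Represents h p₂ u := by
  cases ht with
  | app e h₁ h₂ => exact ⟨_, _, e, h₁, h₂⟩
  | ptr e _ => exact absurd e (hp _)

theorem Represents.lam_inv {h : Heap} {p : Loc} {t : DTerm}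
    (ht : Represents h p (.lam t)) (hp : ∀ q, h.read p ≠ some (.ptr q)) :
    ∃ q, h.read p = some (.lam q) ∧ Represents h q t := by
  cases ht with
  | lam e h => exact ⟨_, e, h⟩
  | ptr e _ => exact absurd e (hp _)

/-- Allocation of a variable reference. -/
theorem Heap.Good.alloc_bv {X : Set Loc} {h : Heap} (g : h.Good X) (i : ℕ) :
    Heap.Good (h ++ [.bv ((i : ℤ) + 1)]) X ∧ h.length ∈ X ∧
      Represents (h ++ [.bv ((i : ℤ) + 1)]) h.length (.var i) := by
  have hr : Represents (h ++ [.bv ((i : ℤ) + 1)]) h.length (.var i) := .bv (read_alloc h _)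
  exact ⟨g.alloc (by simp [RawTerm.refs]) hr, g.fresh _ le_rfl, hr⟩

theorem Heap.Good.alloc_lam {X : Set Loc} {h : Heap} (g : h.Good X) {q : Loc} {t : DTerm}
    (hq : q ∈ X) (ht : Represents h q t) :
    Heap.Good (h ++ [.lam q]) X ∧ h.length ∈ X ∧
      Represents (h ++ [.lam q]) h.length (.lam t) := by
  have hr : Represents (h ++ [.lam q]) h.length (.lam t) :=
    .lam (read_alloc h _) (ht.of_prefix (prefix_alloc h _))
  exact ⟨g.alloc (by simpa [RawTerm.refs] using hq) hr, g.fresh _ le_rfl, hr⟩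

theorem Heap.Good.alloc_app {X : Set Loc} {h : Heap} (g : h.Good X) {q₁ q₂ : Loc}
    {t u : DTerm} (hq₁ : q₁ ∈ X) (hq₂ : q₂ ∈ X) (ht : Represents h q₁ t)
    (hu : Represents h q₂ u) :
    Heap.Good (h ++ [.app q₁ q₂]) X ∧ h.length ∈ X ∧
      Represents (h ++ [.app q₁ q₂]) h.length (.app t u) := by
  have hr : Represents (h ++ [.app q₁ q₂]) h.length (.app t u) :=
    .app (read_alloc h _) (ht.of_prefix (prefix_alloc h _)) (hu.of_prefix (prefix_alloc h _))
  exact ⟨g.alloc (by simp [RawTerm.refs, hq₁, hq₂]) hr, g.fresh _ le_rfl, hr⟩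

theorem S_var_add_zero (t : DTerm) : S t (fun i => .var (i + 0)) = t := S_var t

/-! ### Calculating out a suspension -/

/-- `subst` terminates on `p` in the environment `e`, only allocates new cells, and returns a
representation of `v`. -/
def SubstTo (h : Heap) (X : Set Loc) (p : Loc) (e : Env) (nl : ℕ) (v : DTerm) : Prop :=
  ∃ h' r, (∀ᶠ k in atTop, subst k h p e.length nl e = some (h', r)) ∧ h <+: h' ∧
    h'.Good X ∧ r ∈ X ∧ Represents h' r v

/-- `subst` computes `S(t; …)` on the representations of `t`, in all environments of nesting depth
at most `d`. -/
def SubstSpec (d : ℕ) (t : DTerm) : Prop :=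
  ∀ {h : Heap} {X : Set Loc} {p : Loc} {e : Env} {nl : ℕ} {σ : ℕ → DTerm}, h.Good X → p ∈ X →
    Represents h p t → EnvRep h X d e nl σ → SubstTo h X p e nl (S t σ)

/-- It suffices to consider cells other than `ptr` cells. -/
theorem SubstSpec.of_cell {d : ℕ} {t : DTerm}
    (H : ∀ {h : Heap} {X : Set Loc} {p : Loc} {e : Env} {nl : ℕ} {σ : ℕ → DTerm}, h.Good X →
      p ∈ X → Represents h p t → EnvRep h X d e nl σ → (∀ q, h.read p ≠ some (.ptr q)) →
      SubstTo h X p e nl (S t σ)) : SubstSpec d t := by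
  intro h X p e nl σ g hp ht he
  revert hp
  refine ht.ptr_induction (P := fun p => p ∈ X → SubstTo h X p e nl _)
    (fun p ht hn hp => H g hp ht he hn) ?_
  intro p q hr hq ih hp
  obtain ⟨h', r, h₁, h₂⟩ := ih (g.edge hp (edge_ptr hr))
  refine ⟨h', r, eventually_of_ptr (F := fun k x => subst k h x e.length nl e)
    (fun k x y hx => ?_) hr hq h₁, h₂⟩
  simp [subst, hx]

/-- `subst` computes the substitution denoted by the environment. The recursion is on the
nesting depth of the environment and, for a fixed depth, on the term. -/
theorem subst_spec (d : ℕ) (t : DTerm) : SubstSpec d t := by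
  induction d using Nat.strong_induction_on generalizing t with
  | _ d ihd =>
  induction t with
  | const c =>
    refine SubstSpec.of_cell fun {h X p e nl σ} g hp ht he hn => ?_
    have hr := ht.const_inv hn
    refine ⟨h, p, eventually_of_succ (.of_forall fun k => ?_), List.prefix_rfl, g, hp, ht⟩
    simp [subst, hr]
  | fvar x =>
    refine SubstSpec.of_cell fun {h X p e nl σ} g hp ht he hn => ?_
    have hr := ht.fvar_inv hn
    refine ⟨h, p, eventually_of_succ (.of_forall fun k => ?_), List.prefix_rfl, g, hp, ht⟩
    simp [subst, hr]
  | var i =>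
    refine SubstSpec.of_cell fun {h X p e nl σ} g hp ht he hn => ?_
    have hr := ht.var_inv hn
    change SubstTo h X p e nl (σ i)
    rcases lt_or_ge i e.length with hi | hi
    · have hni : ¬ (i : ℤ) + 1 > e.length := by omega
      rcases he.of_lt_length hi with ⟨l, hl, hnth, hσ⟩ |
        ⟨d', q, t, e', n, σ', rfl, hnth, hq, ht', he', hσ⟩
      · rw [hσ]
        obtain ⟨g', hm, hrep⟩ := g.alloc_bv (nl - l - 1)
        refine ⟨_, _, eventually_of_succ (.of_forall fun k => ?_), prefix_alloc _ _, g', hm, hrep⟩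
        have : ((nl - l - 1 : ℕ) : ℤ) + 1 = nl - l := by omega
        simp [subst, hr, hni, nth_eq_getElem?, hnth, Heap.alloc, this]
      · rw [hσ]
        by_cases hc : e'.length = 0 ∧ nl = 0
        · obtain ⟨he0, rfl⟩ := hc
          obtain rfl := List.length_eq_zero_iff.1 he0
          rw [he'.nil_inv, S_var_add_zero]
          refine ⟨h, q, eventually_of_succ (.of_forall fun k => ?_), List.prefix_rfl, g, hq, ht'⟩
          simp [subst, hr, nth_eq_getElem?, hnth]
          intro hc
          omega
        · obtain ⟨h', r, h₁, h₂⟩ := ihd d' (by omega) t g hq ht' he'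
          refine ⟨h', r, eventually_of_succ ?_, h₂⟩
          filter_upwards [h₁] with k hk
          have hc' : ¬ ((e'.length : ℤ) = 0 ∧ (nl : ℤ) + n - n = 0) := by omega
          have : (nl : ℤ) + n - n = nl := by omega
          simp only [subst, hr, nth_eq_getElem?, hnth, hni, if_neg hc', Option.bind_eq_bind,
            Option.bind_some, if_false]
          rw [this, hk]
    · rw [he.of_length_le hi]
      obtain ⟨g', hm, hrep⟩ := g.alloc_bv (i - e.length + nl)
      refine ⟨_, _, eventually_of_succ (.of_forall fun k => ?_), prefix_alloc _ _, g', hm, hrep⟩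
      have hi' : (i : ℤ) + 1 > e.length := by omega
      have : ((i - e.length + nl : ℕ) : ℤ) + 1 = (i : ℤ) + 1 - e.length + nl := by omega
      simp only [subst, hr, hi', Heap.alloc, this, Option.bind_eq_bind, Option.bind_some, if_true]
  | app t u iht ihu =>
    refine SubstSpec.of_cell fun {h X p e nl σ} g hp ht he hn => ?_
    obtain ⟨p₁, p₂, hr, ht₁, ht₂⟩ := ht.app_inv hn
    obtain ⟨h₁, r₁, c₁, x₁, g₁, m₁, v₁⟩ := iht g (g.edge hp (edge_app_left hr)) ht₁ he
    obtain ⟨h₂, r₂, c₂, x₂, g₂, m₂, v₂⟩ := ihu g₁ (g.edge hp (edge_app_right hr))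
      (ht₂.of_prefix x₁) (he.of_prefix x₁)
    obtain ⟨g₃, m₃, v₃⟩ := g₂.alloc_app m₁ m₂ (v₁.of_prefix x₂) v₂
    refine ⟨_, _, eventually_of_succ ?_, (x₁.trans x₂).trans (prefix_alloc _ _), g₃, m₃, v₃⟩
    filter_upwards [c₁, c₂] with k k₁ k₂
    simp [subst, hr, k₁, k₂, Heap.alloc]
  | lam t ih =>
    refine SubstSpec.of_cell fun {h X p e nl σ} g hp ht he hn => ?_
    obtain ⟨q, hr, ht₁⟩ := ht.lam_inv hn
    obtain ⟨h₁, r₁, c₁, x₁, g₁, m₁, v₁⟩ := ih g (g.edge hp (edge_lam hr)) ht₁ he.lift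
    obtain ⟨g₃, m₃, v₃⟩ := g₁.alloc_lam m₁ v₁
    refine ⟨_, _, eventually_of_succ ?_, x₁.trans (prefix_alloc _ _), g₃, m₃, v₃⟩
    filter_upwards [c₁] with k k₁
    rw [List.length_cons, Nat.cast_succ, Nat.cast_succ] at k₁
    simp [subst, hr, k₁, Heap.alloc]

/-! ### Head normalization -/

/-- The quadruples that `hnEb` returns for a term `v` at embedding level `nl`: in weak mode an
abstraction may come as a suspension at the same level, anything else has been calculated out. -/
inductive Outcome (h : Heap) (X : Set Loc) : Bool → ℕ → Quad → DTerm → Prop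
  | closure {d nl : ℕ} {f : Loc} {e : Env} {b : DTerm} {σ : ℕ → DTerm} : f ∈ X →
      Represents h f (.lam b) → EnvRep h X d e nl σ →
      Outcome h X true nl (f, e.length, nl, e) (S (.lam b) σ)
  | value {w : Bool} {nl : ℕ} {f : Loc} {v : DTerm} : f ∈ X → Represents h f v →
      (w = true → Neutral v) → Outcome h X w nl (f, 0, 0, []) v

namespace Outcome

theorem mono_set {h : Heap} {X Y : Set Loc} (hXY : X ⊆ Y) {w : Bool} {nl : ℕ} {s : Quad}
    {v : DTerm} (ho : Outcome h X w nl s v) : Outcome h Y w nl s v := by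
  cases ho with
  | closure hf hr he => exact .closure (hXY hf) hr (he.mono_set hXY)
  | value hf hr hn => exact .value (hXY hf) hr hn

theorem congr {h h' : Heap} {X : Set Loc}
    (hr : ∀ x ∈ X, ∀ t, Represents h x t → Represents h' x t) {w : Bool} {nl : ℕ} {s : Quad}
    {v : DTerm} (ho : Outcome h X w nl s v) : Outcome h' X w nl s v := by
  cases ho with
  | closure hf ht he => exact .closure hf (hr _ hf _ ht) (he.congr hr)
  | value hf ht hn => exact .value hf (hr _ hf _ ht) hn

theorem represents {h : Heap} {X : Set Loc} {w : Bool} {nl : ℕ} {r : Loc} {v : DTerm}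
    (ho : Outcome h X w nl (r, 0, 0, []) v) : r ∈ X ∧ Represents h r v := by
  generalize hs : ((r, 0, 0, []) : Quad) = s at ho
  cases ho with
  | @closure d nl f e b σ hf ht he =>
    simp only [Prod.mk.injEq] at hs
    obtain ⟨rfl, -, hnl, rfl⟩ := hs
    obtain rfl : nl = 0 := by exact_mod_cast hnl.symm
    rw [he.nil_inv, S_var_add_zero]
    exact ⟨hf, ht⟩
  | value hf ht _ =>
    simp only [Prod.mk.injEq] at hs
    obtain ⟨rfl, -⟩ := hs
    exact ⟨hf, ht⟩

theorem exists_eq {h : Heap} {X : Set Loc} {nl : ℕ} {s : Quad} {v : DTerm}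
    (ho : Outcome h X false nl s v) : ∃ r, s = (r, 0, 0, []) := by
  cases ho
  exact ⟨_, rfl⟩

end Outcome

/-- `hnEb` terminates on `p` in the environment `e`, with working area `X` and an outcome for some
reduct of `v`. In strong mode with the empty environment at level `0`, the cell `p` itself has
been updated to a representation of that reduct. -/
def HnTo (w : Bool) (h : Heap) (X : Set Loc) (p : Loc) (e : Env) (nl : ℕ) (v : DTerm) : Prop :=
  ∃ h' s v', (∀ᶠ k in atTop, hnEb k h p e.length nl e w = some (h', s)) ∧ h'.Good X ∧
    Heap.Step X h h' ∧ BetaReduces v v' ∧ Outcome h' X w nl s v' ∧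
    (w = false → e = [] → nl = 0 → Represents h' p v')

/-- `hnEb` succeeds on the representations of `t` in all environments of nesting depth at
most `d` for which head evaluation of the denoted term costs less than `n`. -/
def HnSpec (n d : ℕ) (t : DTerm) : Prop :=
  ∀ {w : Bool} {m : ℕ} {h : Heap} {X : Set Loc} {p : Loc} {e : Env} {nl : ℕ} {σ : ℕ → DTerm}
    {v : DTerm}, m < n → h.Good X → p ∈ X → Represents h p t → EnvRep h X d e nl σ →
    Eval w m (S t σ) v → HnTo w h X p e nl v

/-- A working area for a call at `p` that contains everything strictly below `p`. In the empty
environment at level `0`, where `p` may be updated, it does not contain `p` itself. -/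
theorem Heap.Good.exists_area {X : Set Loc} {h : Heap} (g : h.Good X) {p : Loc} {t : DTerm}
    (hp : p ∈ X) (ht : Represents h p t) {d : ℕ} {e : Env} {nl : ℕ} {σ : ℕ → DTerm}
    (he : EnvRep h X d e nl σ) :
    ∃ Y ⊆ X, h.Good Y ∧ (∀ q, h.Edge p q → q ∈ Y) ∧ EnvRep h Y d e nl σ ∧
      (e = [] → nl = 0 → p ∉ Y) := by
  by_cases hc : e = [] ∧ nl = 0
  · obtain ⟨rfl, rfl⟩ := hc
    obtain ⟨h₁, h₂, h₃⟩ := g.below hp ht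
    rw [he.nil_inv]
    exact ⟨_, h₂, h₁, fun q hq => .inl (.single hq), .nil _ _, fun _ _ => h₃⟩
  · exact ⟨X, subset_rfl, g, fun q hq => g.edge hp hq, he, fun h₁ h₂ => absurd ⟨h₁, h₂⟩ hc⟩

/-- It suffices to consider cells other than `ptr` cells. At a `ptr` cell the working area is
shrunk so that in the empty environment the cell keeps its contents and points to the result. -/
theorem HnSpec.of_cell {n d : ℕ} {t : DTerm}
    (H : ∀ {w : Bool} {m : ℕ} {h : Heap} {X : Set Loc} {p : Loc} {e : Env} {nl : ℕ}
      {σ : ℕ → DTerm} {v : DTerm}, m < n → h.Good X → p ∈ X → Represents h p t →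
      EnvRep h X d e nl σ → Eval w m (S t σ) v → (∀ q, h.read p ≠ some (.ptr q)) →
      HnTo w h X p e nl v) : HnSpec n d t := by
  intro w m h X p e nl σ v hm g hp ht he hv
  refine ht.ptr_induction
    (P := fun p => ∀ X, h.Good X → EnvRep h X d e nl σ → p ∈ X → HnTo w h X p e nl v)
    (fun p ht hn X g he hp => H hm g hp ht he hv hn) ?_ X g he hp
  intro p q hr hq ih X g he hp
  obtain ⟨Y, hYX, gY, below, heY, hpY⟩ := g.exists_area hp (.ptr hr hq) he
  obtain ⟨h', s, v', c, g', st, hv', ho, hrep⟩ := ih Y gY heY (below q (edge_ptr hr))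
  obtain ⟨st', g''⟩ := st.mono g g' hYX
  refine ⟨h', s, v', ?_, g'', st', hv', ho.mono_set hYX, fun h₁ h₂ h₃ => ?_⟩
  · refine eventually_of_ptr (F := fun k x => hnEb k h x e.length nl e w)
      (fun k x y hx => ?_) hr hq c
    simp [hnEb, hx]
  · refine .ptr ?_ (hrep h₁ h₂ h₃)
    rw [st.frame p (hpY h₂ h₃), hr]

/-- A neutral term that is returned as it stands. -/
theorem HnTo.self {w : Bool} {h : Heap} {X : Set Loc} {p : Loc} {e : Env} {nl : ℕ} {t : DTerm}
    (c : ∀ k, hnEb (k + 1) h p e.length nl e w = some (h, (p, 0, 0, []))) (g : h.Good X)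
    (hp : p ∈ X) (ht : Represents h p t) (hn : Neutral t) : HnTo w h X p e nl t :=
  ⟨h, _, t, eventually_of_succ (.of_forall c), g, g.step_refl, .refl _,
    .value hp ht fun _ => hn, fun _ _ _ => ht⟩

theorem hnSpec_const (n d : ℕ) (c : String) : HnSpec n d (.const c) := by
  refine HnSpec.of_cell fun {w m h X p e nl σ v} hm g hp ht he hv hn => ?_
  obtain rfl := Eval.atom_inv hv trivial
  have hr := ht.const_inv hn
  exact .self (fun k => by simp [hnEb, hr]) g hp ht (.atom trivial)

theorem hnSpec_fvar (n d : ℕ) (x : String) : HnSpec n d (.fvar x) := by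
  refine HnSpec.of_cell fun {w m h X p e nl σ v} hm g hp ht he hv hn => ?_
  obtain rfl := Eval.atom_inv hv trivial
  have hr := ht.fvar_inv hn
  exact .self (fun k => by simp [hnEb, hr]) g hp ht (.atom trivial)

theorem hnSpec_var {n d : ℕ} (ihd : ∀ d' < d, ∀ t, HnSpec n d' t) (i : ℕ) :
    HnSpec n d (.var i) := by
  refine HnSpec.of_cell fun {w m h X p e nl σ v} hm g hp ht he hv hn => ?_
  have hr := ht.var_inv hn
  change Eval w m (σ i) v at hv
  by_cases hnil : e = [] ∧ nl = 0
  · obtain ⟨rfl, rfl⟩ := hnil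
    rw [he.nil_inv] at hv
    obtain rfl := Eval.atom_inv hv trivial
    exact .self (fun k => by simp [hnEb, hr]) g hp ht (.atom trivial)
  have hnil' : ¬ ((e.length : ℤ) = 0 ∧ (nl : ℤ) = 0 ∧ e.isEmpty = true) := by
    rintro ⟨-, h₁, h₂⟩
    exact hnil ⟨List.isEmpty_iff.1 h₂, by exact_mod_cast h₁⟩
  have new : ∀ {j : ℕ} {z : ℤ}, σ i = .var j → z = (j : ℤ) + 1 →
      (∀ k, hnEb (k + 1) h p e.length nl e w = some (h ++ [.bv z], (h.length, 0, 0, []))) →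
      HnTo w h X p e nl v := by
    rintro j z hj rfl c
    rw [hj] at hv
    obtain rfl := Eval.atom_inv hv trivial
    obtain ⟨g', hm', hrep⟩ := g.alloc_bv j
    exact ⟨_, _, _, eventually_of_succ (.of_forall c), g', g.step_of_prefix (prefix_alloc _ _),
      .refl _, .value hm' hrep fun _ => .atom trivial, fun _ h₁ h₂ => absurd ⟨h₁, h₂⟩ hnil⟩
  rcases lt_or_ge i e.length with hi | hi
  · have hni : ¬ (i : ℤ) + 1 > e.length := by omega
    rcases he.of_lt_length hi with ⟨l, hl, hnth, hσ⟩ |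
      ⟨d', q, t, e', n', σ', rfl, hnth, hq, ht', he', hσ⟩
    · refine new hσ (z := nl - l) (by omega) fun k => ?_
      simp only [hnEb, hr, if_neg hnil', hni, nth_eq_getElem?, hnth, Heap.alloc,
        Option.bind_eq_bind, Option.bind_some, if_false]
    · rw [hσ] at hv
      obtain ⟨h', s, v', c, g', st, hv', ho, -⟩ := ihd d' (by omega) t hm g hq ht' he' hv
      refine ⟨h', s, v', eventually_of_succ ?_, g', st, hv', ho,
        fun _ h₁ h₂ => absurd ⟨h₁, h₂⟩ hnil⟩
      filter_upwards [c] with k hk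
      simp only [hnEb, hr, if_neg hnil', hni, nth_eq_getElem?, hnth,
        Option.bind_eq_bind, Option.bind_some, if_false]
      split_ifs with hl
      · rw [hl, hk]
      · rw [add_sub_cancel_right, hk]
  · refine new (he.of_length_le hi) (z := (i : ℤ) + 1 - e.length + nl) (by omega) fun k => ?_
    have hi' : (i : ℤ) + 1 > e.length := by omega
    simp only [hnEb, hr, if_neg hnil', hi', Heap.alloc, Option.bind_eq_bind, Option.bind_some,
      if_true]

theorem hnSpec_lam {n d : ℕ} {t : DTerm} (ih : HnSpec n d t) : HnSpec n d (.lam t) := by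
  refine HnSpec.of_cell fun {w m h X p e nl σ v} hm g hp ht he hv hn => ?_
  obtain ⟨q, hr, hq⟩ := ht.lam_inv hn
  change Eval w m (.lam (S t (liftSubst σ))) v at hv
  cases hv with
  | atom _ h => exact h.elim
  | weakLam b =>
    refine ⟨h, _, _, eventually_of_succ (.of_forall fun k => ?_), g, g.step_refl, .refl _,
      .closure hp ht he, fun h₁ => absurd h₁ (by decide)⟩
    simp [hnEb, hr]
  | @strongLam _ b v hv =>
    by_cases hnil : e = [] ∧ nl = 0
    · obtain ⟨rfl, rfl⟩ := hnil
      obtain ⟨Y, hYX, gY, below, heY, hpY⟩ := g.exists_area hp ht he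
      obtain rfl := heY.nil_inv
      rw [show liftSubst (fun i => .var (i + 0)) = fun i => .var (i + 0) from liftSubst_var] at hv
      obtain ⟨h', s, v', c, g', st, hv', ho, hrep⟩ :=
        ih hm gY (below q (edge_lam hr)) hq heY hv
      obtain ⟨st', g''⟩ := st.mono g g' hYX
      have hrep' : Represents h' p (.lam v') :=
        .lam (by rw [st.frame p (hpY rfl rfl), hr]) (hrep rfl rfl rfl)
      refine ⟨h', (p, 0, 0, []), _, eventually_of_succ ?_, g'', st', hv'.lam,
        .value hp hrep' fun h => absurd h (by decide), fun _ _ _ => hrep'⟩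
      filter_upwards [c] with k hk
      simp only [List.length_nil, Nat.cast_zero] at hk
      simp [hnEb, hr, hk, buildLam]
    · obtain ⟨h', s, v', c, g', st, hv', ho, -⟩ := ih hm g (g.edge hp (edge_lam hr)) hq he.lift hv
      obtain ⟨r, rfl⟩ := ho.exists_eq
      obtain ⟨hm', hrep⟩ := ho.represents
      obtain ⟨g₃, m₃, v₃⟩ := g'.alloc_lam hm' hrep
      refine ⟨_, (h'.length, 0, 0, []), _, eventually_of_succ ?_, g₃,
        st.trans (g'.step_of_prefix (prefix_alloc _ _)), hv'.lam,
        .value m₃ v₃ fun h => absurd h (by decide), fun _ h₁ h₂ => absurd ⟨h₁, h₂⟩ hnil⟩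
      have hnil' : ¬ ((e.length : ℤ) = 0 ∧ (nl : ℤ) = 0) := by
        rintro ⟨h₁, h₂⟩
        exact hnil ⟨List.length_eq_zero_iff.1 (by exact_mod_cast h₁), by exact_mod_cast h₂⟩
      filter_upwards [c] with k hk
      rw [List.length_cons, Nat.cast_succ, Nat.cast_succ] at hk
      simp only [hnEb, hr, if_neg hnil', hk, buildLam, Heap.alloc, Option.bind_eq_bind,
        Option.bind_some, Bool.false_eq_true, if_false]

theorem hnEb_app_lam {k : ℕ} {h h₁ h₂ : Heap} {p p₁ p₂ f g q : Loc} {ol nl fo fl : ℤ}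
    {e ef : Env} {w : Bool} {s : Quad} {x : Heap × Quad} (hp : h.read p = some (.app p₁ p₂))
    (c₁ : hnEb k h p₁ ol nl e true = some (h₁, (f, fo, fl, ef)))
    (hd : deref k h₁ f = some g) (hg : h₁.read g = some (.lam q))
    (c₂ : hnEb k h₁ q (fo + 1) fl (.bndg p₂ ol nl e nl :: ef) w = some (h₂, s))
    (c₃ : updateApp k h₂ p s ol nl = some x) : hnEb (k + 1) h p ol nl e w = some x := by
  simp [hnEb, hp, c₁, hd, hg, c₂, c₃]

theorem hnEb_app_neutral {k : ℕ} {h h₁ : Heap} {p p₁ p₂ f g : Loc} {ol nl fo fl : ℤ}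
    {e ef : Env} {w : Bool} {x : Heap × Quad} (hp : h.read p = some (.app p₁ p₂))
    (c₁ : hnEb k h p₁ ol nl e true = some (h₁, (f, fo, fl, ef)))
    (hd : deref k h₁ f = some g) {r : RawTerm} (hg : h₁.read g = some r)
    (hn : ∀ q, r ≠ .lam q) (c₂ : buildApp k h₁ p g p₂ ol nl e = some x) :
    hnEb (k + 1) h p ol nl e w = some x := by
  cases r <;> simp_all [hnEb]

/-- The update step after a contraction. The recursive calls, which led from `h` to `h'` with the
quadruple `s`, enter through `c`. -/
theorem HnTo.updateApp {w : Bool} {h h' : Heap} {X Y : Set Loc} {p : Loc} {e : Env} {nl : ℕ}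
    {σ : ℕ → DTerm} {d : ℕ} {t v v' : DTerm} {s : Quad} (g : h.Good X) (g' : h'.Good Y)
    (st : Heap.Step Y h h') (hYX : Y ⊆ X) (hp : p ∈ X) (ht : Represents h p t)
    (he : EnvRep h X d e nl σ) (hpY : e = [] → nl = 0 → p ∉ Y)
    (ho : Outcome h' Y w nl s v') (htv : BetaReduces (S t σ) v) (hv : BetaReduces v v')
    (c : ∀ {x}, (∀ᶠ k in atTop, EnvReduction.updateApp k h' p s e.length nl = some x) →
      ∀ᶠ k in atTop, hnEb k h p e.length nl e w = some x) :
    HnTo w h X p e nl v := by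
  by_cases hc : (e = [] ∧ nl = 0) ∧ ∃ r, s = (r, 0, 0, [])
  · obtain ⟨⟨rfl, rfl⟩, r, rfl⟩ := hc
    obtain ⟨hr, hrep⟩ := ho.represents
    obtain ⟨r', -, ha, hrep', -, hreach⟩ := hrep.exists_deref
    rw [he.nil_inv, S_var_add_zero] at htv
    obtain ⟨st', g'', hpv, old⟩ := Heap.Step.write g g' st hYX hp (hpY rfl rfl) ht
      (g'.of_reachable hr hreach) hrep' (htv.trans hv)
    refine ⟨_, _, v', c ?_, g'', st', hv, (ho.congr old).mono_set hYX, fun _ _ _ => hpv⟩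
    filter_upwards [ha p] with k hk
    simp [EnvReduction.updateApp, hk]
  · obtain ⟨st', g''⟩ := st.mono g g' hYX
    refine ⟨_, _, v', c ?_, g'', st', hv, ho.mono_set hYX, ?_⟩
    · refine .of_forall fun k => ?_
      obtain ⟨r, sol, snl, senv⟩ := s
      have hc' : ¬ (sol = 0 ∧ snl = 0 ∧ senv.isEmpty = true ∧ (e.length : ℤ) = 0 ∧
          (nl : ℤ) = 0) := by
        rintro ⟨rfl, rfl, h₁, h₂, h₃⟩
        obtain rfl := List.isEmpty_iff.1 h₁
        exact hc ⟨⟨List.length_eq_zero_iff.1 (by exact_mod_cast h₂), by exact_mod_cast h₃⟩, r, rfl⟩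
      simp only [EnvReduction.updateApp, if_neg hc']
    · rintro rfl h₁ h₂
      exact absurd ⟨⟨h₁, h₂⟩, ho.exists_eq⟩ hc

/-- Rebuilding an application of the neutral term at `f` to the argument at `q`. The recursive
call, which led from `h` to `h'`, enters through `c`. -/
theorem HnTo.buildApp {w : Bool} {h h' : Heap} {X Y : Set Loc} {p f q : Loc} {e : Env} {nl : ℕ}
    {σ σ' : ℕ → DTerm} {d d' : ℕ} {t a b u a' : DTerm} (g : h.Good X) (g' : h'.Good Y)
    (st : Heap.Step Y h h') (hYX : Y ⊆ X) (hp : p ∈ X) (ht : Represents h p t)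
    (he : EnvRep h X d e nl σ) (hpY : e = [] → nl = 0 → p ∉ Y) (hf : f ∈ Y)
    (hfr : Represents h' f a') (ha' : Neutral a') (hq : q ∈ Y) (hqr : Represents h' q u)
    (he' : EnvRep h' Y d' e nl σ') (htv : BetaReduces (S t σ) (app a b))
    (ha : BetaReduces a a') (hb : BetaReduces b (S u σ'))
    (c : ∀ {x}, (∀ᶠ k in atTop, EnvReduction.buildApp k h' p f q e.length nl e = some x) →
      ∀ᶠ k in atTop, hnEb k h p e.length nl e w = some x) :
    HnTo w h X p e nl (app a b) := by
  have hv : BetaReduces (app a b) (app a' (S u σ')) := ha.app hb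
  by_cases hc : e = [] ∧ nl = 0
  · obtain ⟨rfl, rfl⟩ := hc
    rw [he'.nil_inv, S_var_add_zero] at hv
    rw [he.nil_inv, S_var_add_zero] at htv
    obtain ⟨g₁, m₁, r₁⟩ := g'.alloc_app hf hq hfr hqr
    obtain ⟨st', g'', hpv, -⟩ := Heap.Step.write g g₁
      (st.trans (g'.step_of_prefix (prefix_alloc _ _))) hYX hp (hpY rfl rfl) ht m₁ r₁
      (htv.trans hv)
    refine ⟨_, (p, 0, 0, []), _, c (eventually_of_succ (.of_forall fun k => ?_)), g'', st', hv,
      .value hp hpv fun _ => .app _ ha', fun _ _ _ => hpv⟩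
    simp [EnvReduction.buildApp, Heap.alloc, assign, read_alloc]
  · have hc' : ¬ ((e.length : ℤ) = 0 ∧ (nl : ℤ) = 0 ∧ e.isEmpty = true) := by
      rintro ⟨-, h₁, h₂⟩
      exact hc ⟨List.isEmpty_iff.1 h₂, by exact_mod_cast h₁⟩
    obtain ⟨h₂, r, cs, hx, g₂, m₂, v₂⟩ := subst_spec d' u g' hq hqr he'
    obtain ⟨g₃, m₃, v₃⟩ := g₂.alloc_app hf m₂ (hfr.of_prefix hx) v₂
    obtain ⟨st', g''⟩ := (st.trans (g'.step_of_prefix (hx.trans (prefix_alloc _ _)))).mono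
      g g₃ hYX
    refine ⟨_, (h₂.length, 0, 0, []), _, c ?_, g'', st', hv,
      .value (hYX m₃) v₃ fun _ => .app _ ha', fun _ h₁ h₂ => absurd ⟨h₁, h₂⟩ hc⟩
    filter_upwards [cs] with k hk
    simp only [EnvReduction.buildApp, if_neg hc', hk, Heap.alloc, Option.bind_eq_bind,
      Option.bind_some]

theorem hnSpec_app {n d : ℕ} {t u : DTerm} (ihn : ∀ n' < n, ∀ d t, HnSpec n' d t)
    (iht : HnSpec n d t) : HnSpec n d (.app t u) := by
  refine HnSpec.of_cell fun {w m h X p e nl σ v} hm g hp ht he hv hn => ?_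
  obtain ⟨p₁, p₂, hr, ht₁, ht₂⟩ := ht.app_inv hn
  have hev := hv.reduces
  change Eval w m (.app (S t σ) (S u σ)) v at hv
  obtain ⟨Y, hYX, gY, below, heY, hpY⟩ := g.exists_area hp ht he
  have hp₁ := below p₁ (edge_app_left hr)
  have hp₂ := below p₂ (edge_app_right hr)
  cases hv with
  | atom _ h => exact h.elim
  | @beta _ a b _ body _ _ h₁ h₂ =>
    obtain ⟨h', s, v₁, c₁, g₁, st₁, hv₁, ho₁, -⟩ := iht (by omega) gY hp₁ ht₁ heY h₁
    obtain ⟨b', rfl, hb'⟩ := hv₁.lam_inv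
    generalize hl : DTerm.lam b' = l at ho₁
    cases ho₁ with
    | value _ _ hneu => exact absurd (hl ▸ hneu rfl) not_neutral_lam
    | @closure d₁ _ f ef B σ₁ hf hfr hef =>
      simp only [S, DTerm.lam.injEq] at hl
      subst hl
      obtain ⟨gc, hd, -, hgr, hgn, hreach⟩ := hfr.exists_deref
      obtain ⟨q, hq, hB⟩ := hgr.lam_inv hgn
      have hqY : q ∈ Y := g₁.edge (g₁.of_reachable hf hreach) (edge_lam hq)
      obtain ⟨σ', hσ, heσ⟩ := heY.step st₁
      obtain ⟨u', hu, hur⟩ := st₁.reduces ht₂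
      -- The argument and the environment may have been reduced meanwhile, which does not
      -- increase the cost of the contractum.
      obtain ⟨m', hm', v', hvv', hev'⟩ := h₂.of_reduces (hb'.contractum (hu.S hσ))
      rw [S_liftSubst_single] at hev'
      obtain ⟨h'', s, v'', c₂, g₂, st₂, hv'', ho₂, -⟩ := ihn (m' + 1) (by omega) _ B
        (Nat.lt_succ_self m') g₁ hqY hB (.bind hp₂ hur heσ hef) hev'
      refine HnTo.updateApp g g₂ (st₁.trans st₂) hYX hp ht he hpY ho₂ hev
        (hvv'.trans hv'') fun {x} c₃ => eventually_of_succ ?_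
      filter_upwards [c₁, c₂, c₃, hd] with k k₁ k₂ k₃ k₄
      rw [List.length_cons, Nat.cast_succ] at k₂
      exact hnEb_app_lam hr k₁ k₄ hq k₂ k₃
  | @neutral _ _ _ a _ h₁ hneu =>
    obtain ⟨h', s, a', c₁, g₁, st₁, ha', ho₁, -⟩ := iht hm gY hp₁ ht₁ heY h₁
    have hneu' := hneu.reduces ha'
    cases ho₁ with
    | closure _ _ _ => exact absurd hneu' not_neutral_lam
    | @value _ _ f _ hf hfr _ =>
      obtain ⟨gc, hd, -, hgr, hgn, hreach⟩ := hfr.exists_deref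
      obtain ⟨r, hgc⟩ := hgr.read_isSome
      have hnl : ∀ q, r ≠ .lam q := by
        rintro q rfl
        cases hgr with
        | lam _ _ => exact not_neutral_lam hneu'
        | _ => simp_all
      obtain ⟨σ', hσ, heσ⟩ := heY.step st₁
      obtain ⟨u', hu, hur⟩ := st₁.reduces ht₂
      refine HnTo.buildApp g g₁ st₁ hYX hp ht he hpY (g₁.of_reachable hf hreach) hgr hneu' hp₂
        hur heσ (h₁.reduces.app (.refl _)) ha' (hu.S hσ) fun {x} c₃ => eventually_of_succ ?_
      filter_upwards [c₁, c₃, hd] with k k₁ k₃ k₄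
      exact hnEb_app_neutral hr k₁ k₄ hgc hnl k₃

/-- Head normalization succeeds whenever head evaluation of the denoted term does. The recursion
is on the cost of that evaluation, the nesting depth of the environment, and the term. -/
theorem hnEb_spec (n d : ℕ) (t : DTerm) : HnSpec n d t := by
  induction n using Nat.strong_induction_on generalizing d t with
  | _ n ihn =>
  induction d using Nat.strong_induction_on generalizing t with
  | _ d ihd =>
  induction t with
  | const c => exact hnSpec_const n d c
  | fvar x => exact hnSpec_fvar n d x
  | var i => exact hnSpec_var ihd i
  | app t u iht _ => exact hnSpec_app ihn iht
  | lam t ih => exact hnSpec_lam ih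

/-! ### Acyclicity -/

/-- A computation in a working area creates no cycles: in the area the store consists of
representations, and outside it is unchanged. -/
theorem Heap.Step.acyclic {X : Set Loc} {h h' : Heap} (st : Heap.Step X h h')
    (g' : h'.Good X) {p : Loc} (hp : h.Acyclic p) : h'.Acyclic p := by
  intro q hpq hqq
  by_cases hq : q ∈ X
  · obtain ⟨r, ⟨c, hc, -⟩, -⟩ := Relation.TransGen.head'_iff.1 hqq
    obtain ⟨t, ht⟩ := g'.represents q hq (List.getElem?_eq_some_iff.1 hc).1
    exact ht.not_transGen hqq
  · -- A path that ends outside the closed set `X` never meets it.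
    have back : ∀ {x y}, h'.Edge x y → y ∉ X → x ∉ X ∧ h.Edge x y := by
      intro x y he hy
      have hx : x ∉ X := fun hx => hy (g'.edge hx he)
      obtain ⟨c, hc, hyc⟩ := he
      exact ⟨hx, c, st.frame x hx ▸ hc, hyc⟩
    have path : ∀ {x}, Relation.ReflTransGen h'.Edge x q →
        x ∉ X ∧ Relation.ReflTransGen h.Edge x q := by
      intro x hx
      induction hx using Relation.ReflTransGen.head_induction_on with
      | refl => exact ⟨hq, .refl⟩
      | head he _ ih =>
        obtain ⟨hx, he'⟩ := back he ih.1
        exact ⟨hx, .head he' ih.2⟩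
    obtain ⟨r, hqr, hrq⟩ := Relation.TransGen.head'_iff.1 hqq
    obtain ⟨hr, hrq'⟩ := path hrq
    exact hp q (path hpq).2 (Relation.TransGen.head' (back hqr hr).2 hrq')

/-- The cells reachable from a representation, together with the future ones. -/
theorem Represents.exists_good {h : Heap} {p : Loc} {t : DTerm} (ht : Represents h p t) :
    ∃ X, h.Good X ∧ p ∈ X := by
  refine ⟨{x | Relation.ReflTransGen h.Edge p x ∨ h.length ≤ x}, ⟨fun x hx => .inr hx, ?_, ?_⟩,
    .inl .refl⟩
  · rintro x (hx | hx) hl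
    · exact ht.of_reachable hx
    · exact absurd hl (not_lt.2 hx)
  · rintro x y (hx | hx) he
    · exact .inl (hx.tail he)
    · obtain ⟨r, hr, _⟩ := he
      exact absurd (List.getElem?_eq_some_iff.1 hr).1 (not_lt.2 hx)

end EnvReduction

theorem mainTheorem1 (h : EnvReduction.Heap) (t' : EnvReduction.Loc) (t : EnvReduction.DTerm)
    (hacyclic : h.Acyclic t')
    (hrep : EnvReduction.Represents h t' t)
    (hhnf : ∃ s, EnvReduction.DTerm.IsHNFOf s t) :
    ∃ (h' : EnvReduction.Heap) (r' : EnvReduction.Loc) (r : EnvReduction.DTerm),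
      (∃ n, ∀ k ≥ n, EnvReduction.headNorm1 k h t' = some (h', (r', 0, 0, []))) ∧
      (∀ p, h.Acyclic p → h'.Acyclic p) ∧
      EnvReduction.DTerm.IsHNFOf r t ∧
      EnvReduction.Represents h' t' r ∧
      EnvReduction.Represents h' r' r := by
  obtain ⟨s, hs⟩ := hhnf
  obtain ⟨n, v, hv⟩ := hs.exists_eval
  obtain ⟨X, g, ht'⟩ := hrep.exists_good
  obtain ⟨h', s', v', c, g', st, hvv', ho, hr⟩ := EnvReduction.hnEb_spec (n + 1) 0 t
    (Nat.lt_succ_self n) g ht' hrep (.nil 0 0) (by rwa [EnvReduction.S_var_add_zero])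
  obtain ⟨r', rfl⟩ := ho.exists_eq
  exact ⟨h', r', v', Filter.eventually_atTop.1 c, fun p hp => st.acyclic g' hp,
    ⟨hv.reduces.trans hvv', ((hv.hnf rfl).reduces hvv').isHNF⟩, hr rfl rfl rfl,
    ho.represents.2⟩
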